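/- Throughout, double categories and double functors are pseudo: arrows compose strictly, while proarrows compose (written $\odot$, in diagrammatic order) up to coherent isomorphism. A \emph{companion} of an arrow $f\colon x\to y$ is a proarrow $f_!\colon x\nrightarrow y$ with cells $\eta\colon \mathrm{id}_x\to f_!$ (left arrow $1_x$, right arrow $f$) and $\varepsilon\colon f_!\to \mathrm{id}_y$ (left arrow $f$, right arrow $1_y$) such that $\eta\odot\varepsilon=1_{f_!}$ (up to unitors) and $\eta\cdot\varepsilon=\mathrm{id}_f$. Given companions $f_!,g_!$, a cell $\alpha$ with left arrow $f$, right arrow $g$, top $m$ and bottom $n$ is a \emph{commuter} if the globular cell $\alpha_!\colon m\odot g_!\to f_!\odot n$, obtained by pasting $\alpha$ with the unit of $f_!$ and the counit of $g_!$, is invertible. An \emph{oplax protransformation} $\tau\colon H\nrightarrow K$ between double functors consists of proarrows $\tau_x\colon Hx\nrightarrow Kx$, cells $\tau_f$ functorial in the arrow $f$, and globular comparison cells $\tau_m\colon Hm\odot\tau_y\to\tau_x\odot Km$ for proarrows $m\colon x\nrightarrow y$, natural in cells and coherent for external composition and identities; it is a (pseudo) \emph{protransformation} if all $\tau_m$ are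 invertible. \textbf{Theorem.} Let $(\eta,\varepsilon)\colon F\dashv G$, with $F\colon\mathbb D\to\mathbb E$ and $G\colon\mathbb E\to\mathbb D$, be an adjunction in the 2-category of double categories, double functors and natural transformations, and suppose that all component arrows $\eta_x\colon x\to GFx$ and $\varepsilon_y\colon FGy\to y$ have companions. For any choice of companions $(\eta_x)_!$ and $(\varepsilon_y)_!$ (with their units and counits) there are (i) oplax protransformations $\eta_!\colon 1_{\mathbb D}\nrightarrow GF$ and $\varepsilon_!\colon FG\nrightarrow 1_{\mathbb E}$ that are companions of $\eta$ and $\varepsilon$ in the double categories of double functors, natural transformations, oplax protransformations and modifications, and whose underlying companions at objects are the chosen ones; (ii) invertible modifications $s\colon 1_F\to (F*\eta_!)\odot(\varepsilon_!*F)$ and $t\colon(\eta_!*G)\odot(G*\varepsilon_!)\to 1_G$ of oplax protransformations; such that $(\eta_!,\varepsilon_!,s,t)$ is a lax adjunction, i.e. the two swallowtail identities hold. Namely, for every $x\in\mathbb D$ the composite (associators, unitors and the comparison cells of $G$ suppressed) $$(\eta_!)_x \xrightarrow{1\odot t_{Fx}^{-1}} (\eta_!)_x\odot(\eta_!)_{GFx}\odot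 G(\varepsilon_!)_{Fx}\xrightarrow{(\eta_!)_{(\eta_!)_x}\odot 1}(\eta_!)_x\odot GF(\eta_!)_x\odot G(\varepsilon_!)_{Fx}\xrightarrow{1\odot G s_x^{-1}}(\eta_!)_x$$ is the identity, and for every $y\in\mathbb E$ the composite $$(\varepsilon_!)_y \xrightarrow{F t_y^{-1}\odot 1} F(\eta_!)_{Gy}\odot FG(\varepsilon_!)_y\odot(\varepsilon_!)_y\xrightarrow{1\odot(\varepsilon_!)_{(\varepsilon_!)_y}}F(\eta_!)_{Gy}\odot(\varepsilon_!)_{FGy}\odot(\varepsilon_!)_y\xrightarrow{s_{Gy}^{-1}\odot 1}(\varepsilon_!)_y$$ is the identity. The comparison cells $(\eta_!)_{(\eta_!)_x}$ and $(\varepsilon_!)_{(\varepsilon_!)_y}$ occurring here are invertible. If, moreover, all component cells $\eta_m$ and $\varepsilon_m$ at proarrows $m$ are commuters, then $\eta_!$ and $\varepsilon_!$ are (pseudo) protransformations, so that $(\eta_!,\varepsilon_!,s,t)$ is a biadjunction. -/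

import Mathlib

open CategoryTheory

universe w t v u w₁ t₁ v₁ u₁ w₂ t₂ v₂ u₂

/-- A (pseudo) double category with class of objects `D`: arrows `x ⟶ y` form a category, and
there are proarrows `Pro x y` and cells `Cell f g m n`, with left arrow `f`, right arrow `g`,
top proarrow `m` and bottom proarrow `n`. Internal (vertical) composition of cells is strictly
associative and unital; external (horizontal) composition, written in diagrammatic order, is so up
to globular associators and unitors.

So that no transport of cells along equations between arrows is needed, the internal composite
`vcomp α β hl hr` of cells with left arrows `f`, `f'` and right arrows `g`, `g'` may be formed over
any arrows `k`, `l` with `hl : f ≫ f' = k` and `hr : g ≫ g' = l`. -/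
class DoubleCategory (D : Type u) extends Category.{v} D where
  Pro : D → D → Type w
  Cell : ∀ {x y x' y' : D}, (x ⟶ x') → (y ⟶ y') → Pro x y → Pro x' y' → Type t
  /-- The internal identity cell `1_m`. -/
  vid : ∀ {x y : D} (m : Pro x y), Cell (𝟙 x) (𝟙 y) m m
  /-- Internal composition of cells. -/
  vcomp : ∀ {x y x' y' x'' y'' : D} {f : x ⟶ x'} {f' : x' ⟶ x''} {k : x ⟶ x''}
    {g : y ⟶ y'} {g' : y' ⟶ y''} {l : y ⟶ y''} {m : Pro x y} {n : Pro x' y'} {p : Pro x'' y''},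
    Cell f g m n → Cell f' g' n p → f ≫ f' = k → g ≫ g' = l → Cell k l m p
  vid_vcomp : ∀ {x y x' y' : D} {f : x ⟶ x'} {g : y ⟶ y'} {m : Pro x y} {n : Pro x' y'}
    (α : Cell f g m n), vcomp (vid m) α (Category.id_comp f) (Category.id_comp g) = α
  vcomp_vid : ∀ {x y x' y' : D} {f : x ⟶ x'} {g : y ⟶ y'} {m : Pro x y} {n : Pro x' y'}
    (α : Cell f g m n), vcomp α (vid n) (Category.comp_id f) (Category.comp_id g) = α
  vcomp_assoc : ∀ {x y x' y' x'' y'' x''' y''' : D}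
    {f : x ⟶ x'} {f' : x' ⟶ x''} {f'' : x'' ⟶ x'''} {g : y ⟶ y'} {g' : y' ⟶ y''} {g'' : y'' ⟶ y'''}
    {m : Pro x y} {n : Pro x' y'} {p : Pro x'' y''} {q : Pro x''' y'''}
    (α : Cell f g m n) (β : Cell f' g' n p) (γ : Cell f'' g'' p q),
    vcomp (vcomp α β rfl rfl) γ (Category.assoc f f' f'') (Category.assoc g g' g'') =
      vcomp α (vcomp β γ rfl rfl) rfl rfl
  /-- The external identity proarrow `id_x`. -/
  pid : ∀ x : D, Pro x x
  /-- External composition of proarrows. -/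
  pcomp : ∀ {x y z : D}, Pro x y → Pro y z → Pro x z
  /-- The external identity cell `id_f`. -/
  hid : ∀ {x y : D} (f : x ⟶ y), Cell f f (pid x) (pid y)
  /-- External composition of cells. -/
  hcomp : ∀ {x y z x' y' z' : D} {f : x ⟶ x'} {g : y ⟶ y'} {h : z ⟶ z'}
    {m : Pro x y} {n : Pro y z} {m' : Pro x' y'} {n' : Pro y' z'},
    Cell f g m m' → Cell g h n n' → Cell f h (pcomp m n) (pcomp m' n')
  hid_id : ∀ x : D, hid (𝟙 x) = vid (pid x)
  hid_comp : ∀ {x y z : D} (f : x ⟶ y) (g : y ⟶ z),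
    hid (f ≫ g) = vcomp (hid f) (hid g) rfl rfl
  hcomp_vid : ∀ {x y z : D} (m : Pro x y) (n : Pro y z), hcomp (vid m) (vid n) = vid (pcomp m n)
  /-- Interchange. -/
  hcomp_vcomp : ∀ {x y z x' y' z' x'' y'' z'' : D} {f : x ⟶ x'} {g : y ⟶ y'} {h : z ⟶ z'}
    {f' : x' ⟶ x''} {g' : y' ⟶ y''} {h' : z' ⟶ z''}
    {m : Pro x y} {n : Pro y z} {m' : Pro x' y'} {n' : Pro y' z'}
    {m'' : Pro x'' y''} {n'' : Pro y'' z''}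
    (α : Cell f g m m') (β : Cell g h n n') (α' : Cell f' g' m' m'') (β' : Cell g' h' n' n''),
    hcomp (vcomp α α' rfl rfl) (vcomp β β' rfl rfl) = vcomp (hcomp α β) (hcomp α' β') rfl rfl
  /-- The associator and its inverse. -/
  associator : ∀ {a b c d : D} (m : Pro a b) (n : Pro b c) (p : Pro c d),
    Cell (𝟙 a) (𝟙 d) (pcomp (pcomp m n) p) (pcomp m (pcomp n p))
  associatorInv : ∀ {a b c d : D} (m : Pro a b) (n : Pro b c) (p : Pro c d),
    Cell (𝟙 a) (𝟙 d) (pcomp m (pcomp n p)) (pcomp (pcomp m n) p)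
  associator_associatorInv : ∀ {a b c d : D} (m : Pro a b) (n : Pro b c) (p : Pro c d),
    vcomp (associator m n p) (associatorInv m n p) (Category.id_comp _) (Category.id_comp _) = vid _
  associatorInv_associator : ∀ {a b c d : D} (m : Pro a b) (n : Pro b c) (p : Pro c d),
    vcomp (associatorInv m n p) (associator m n p) (Category.id_comp _) (Category.id_comp _) = vid _
  associator_naturality : ∀ {a b c d a' b' c' d' : D}
    {f : a ⟶ a'} {g : b ⟶ b'} {h : c ⟶ c'} {k : d ⟶ d'}
    {m : Pro a b} {n : Pro b c} {p : Pro c d} {m' : Pro a' b'} {n' : Pro b' c'} {p' : Pro c' d'}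
    (α : Cell f g m m') (β : Cell g h n n') (γ : Cell h k p p'),
    vcomp (hcomp (hcomp α β) γ) (associator m' n' p') (Category.comp_id f) (Category.comp_id k) =
      vcomp (associator m n p) (hcomp α (hcomp β γ)) (Category.id_comp f) (Category.id_comp k)
  /-- The left unitor and its inverse. -/
  lunit : ∀ {x y : D} (m : Pro x y), Cell (𝟙 x) (𝟙 y) (pcomp (pid x) m) m
  lunitInv : ∀ {x y : D} (m : Pro x y), Cell (𝟙 x) (𝟙 y) m (pcomp (pid x) m)
  lunit_lunitInv : ∀ {x y : D} (m : Pro x y),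
    vcomp (lunit m) (lunitInv m) (Category.id_comp _) (Category.id_comp _) = vid _
  lunitInv_lunit : ∀ {x y : D} (m : Pro x y),
    vcomp (lunitInv m) (lunit m) (Category.id_comp _) (Category.id_comp _) = vid _
  lunit_naturality : ∀ {x y x' y' : D} {f : x ⟶ x'} {g : y ⟶ y'} {m : Pro x y} {n : Pro x' y'}
    (α : Cell f g m n),
    vcomp (hcomp (hid f) α) (lunit n) (Category.comp_id f) (Category.comp_id g) =
      vcomp (lunit m) α (Category.id_comp f) (Category.id_comp g)
  /-- The right unitor and its inverse. -/
  runit : ∀ {x y : D} (m : Pro x y), Cell (𝟙 x) (𝟙 y) (pcomp m (pid y)) m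
  runitInv : ∀ {x y : D} (m : Pro x y), Cell (𝟙 x) (𝟙 y) m (pcomp m (pid y))
  runit_runitInv : ∀ {x y : D} (m : Pro x y),
    vcomp (runit m) (runitInv m) (Category.id_comp _) (Category.id_comp _) = vid _
  runitInv_runit : ∀ {x y : D} (m : Pro x y),
    vcomp (runitInv m) (runit m) (Category.id_comp _) (Category.id_comp _) = vid _
  runit_naturality : ∀ {x y x' y' : D} {f : x ⟶ x'} {g : y ⟶ y'} {m : Pro x y} {n : Pro x' y'}
    (α : Cell f g m n),
    vcomp (hcomp α (hid g)) (runit n) (Category.comp_id f) (Category.comp_id g) =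
      vcomp (runit m) α (Category.id_comp f) (Category.id_comp g)
  pentagon : ∀ {a b c d e : D} (m : Pro a b) (n : Pro b c) (p : Pro c d) (q : Pro d e),
    vcomp (vcomp (hcomp (associator m n p) (vid q)) (associator m (pcomp n p) q)
        (Category.id_comp _) (Category.id_comp _))
      (hcomp (vid m) (associator n p q)) (Category.id_comp _) (Category.id_comp _) =
    vcomp (associator (pcomp m n) p q) (associator m n (pcomp p q)) (Category.id_comp _) (Category.id_comp _)
  triangle : ∀ {a b c : D} (m : Pro a b) (n : Pro b c),
    vcomp (associator m (pid b) n) (hcomp (vid m) (lunit n)) (Category.id_comp _) (Category.id_comp _) =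
      hcomp (runit m) (vid n)

namespace DoubleCategory

section Cells

variable {D : Type u} [DoubleCategory.{w, t, v} D]

/-- Globular cells, i.e. cells whose left and right arrows are identities. -/
abbrev GCell {x y : D} (m n : Pro x y) := Cell (𝟙 x) (𝟙 y) m n

/-- Internal composition of globular cells. -/
abbrev gcomp {x y : D} {m n p : Pro x y} (α : GCell m n) (β : GCell n p) : GCell m p :=
  vcomp α β (Category.id_comp _) (Category.id_comp _)

/-- Rewriting the left and right arrows of a cell along equations. -/
def castCell {x y x' y' : D} {f f' : x ⟶ x'} {g g' : y ⟶ y'} {m : Pro x y} {n : Pro x' y'}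
    (hf : f = f') (hg : g = g') (α : Cell f g m n) : Cell f' g' m n :=
  hf ▸ hg ▸ α

/-- A globular cell is invertible if it has an inverse under internal composition. -/
def IsInvertible {x y : D} {m n : Pro x y} (α : GCell m n) : Prop :=
  ∃ β : GCell n m, gcomp α β = vid m ∧ gcomp β α = vid n

theorem castCell_vcomp {x y x' y' x'' y'' : D} {f : x ⟶ x'} {f' : x' ⟶ x''} {k k' : x ⟶ x''}
    {g : y ⟶ y'} {g' : y' ⟶ y''} {l l' : y ⟶ y''} {m : Pro x y} {n : Pro x' y'} {p : Pro x'' y''}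
    (α : Cell f g m n) (β : Cell f' g' n p) (hk : f ≫ f' = k) (hl : g ≫ g' = l)
    (hk' : k = k') (hl' : l = l') :
    castCell hk' hl' (vcomp α β hk hl) = vcomp α β (hk.trans hk') (hl.trans hl') := by
  subst hk' hl'
  rfl

theorem vcomp_castCell {x y x' y' x'' y'' : D} {f : x ⟶ x'} {f' f₁ : x' ⟶ x''} {k : x ⟶ x''}
    {g : y ⟶ y'} {g' g₁ : y' ⟶ y''} {l : y ⟶ y''} {m : Pro x y} {n : Pro x' y'} {p : Pro x'' y''}
    (α : Cell f g m n) (β : Cell f' g' n p) (hf : f' = f₁) (hg : g' = g₁)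
    (hk : f ≫ f₁ = k) (hl : g ≫ g₁ = l) :
    vcomp α (castCell hf hg β) hk hl =
      vcomp α β ((congrArg (f ≫ ·) hf).trans hk) ((congrArg (g ≫ ·) hg).trans hl) := by
  subst hf hg
  rfl

theorem castCell_vcomp_left {x y x' y' x'' y'' : D} {f f₁ : x ⟶ x'} {f' : x' ⟶ x''} {k : x ⟶ x''}
    {g g₁ : y ⟶ y'} {g' : y' ⟶ y''} {l : y ⟶ y''} {m : Pro x y} {n : Pro x' y'} {p : Pro x'' y''}
    (α : Cell f g m n) (β : Cell f' g' n p) (hf : f = f₁) (hg : g = g₁)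
    (hk : f₁ ≫ f' = k) (hl : g₁ ≫ g' = l) :
    vcomp (castCell hf hg α) β hk hl =
      vcomp α β ((congrArg (· ≫ f') hf).trans hk) ((congrArg (· ≫ g') hg).trans hl) := by
  subst hf hg
  rfl

theorem castCell_castCell {x y x' y' : D} {f f' f'' : x ⟶ x'} {g g' g'' : y ⟶ y'} {m : Pro x y}
    {n : Pro x' y'} (hf : f = f') (hg : g = g') (hf' : f' = f'') (hg' : g' = g'')
    (α : Cell f g m n) :
    castCell hf' hg' (castCell hf hg α) = castCell (hf.trans hf') (hg.trans hg') α := by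
  subst hf hg hf' hg'
  rfl

theorem vcomp_assoc' {x y x' y' x'' y'' x''' y''' : D}
    {f : x ⟶ x'} {f' : x' ⟶ x''} {f'' : x'' ⟶ x'''} {g : y ⟶ y'} {g' : y' ⟶ y''} {g'' : y'' ⟶ y'''}
    {k : x ⟶ x''} {l : y ⟶ y''} {k' : x' ⟶ x'''} {l' : y' ⟶ y'''} {j : x ⟶ x'''} {i : y ⟶ y'''}
    {m : Pro x y} {n : Pro x' y'} {p : Pro x'' y''} {q : Pro x''' y'''}
    (α : Cell f g m n) (β : Cell f' g' n p) (γ : Cell f'' g'' p q)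
    (hk : f ≫ f' = k) (hl : g ≫ g' = l) (hj : k ≫ f'' = j) (hi : l ≫ g'' = i)
    (hk' : f' ≫ f'' = k') (hl' : g' ≫ g'' = l') (hj' : f ≫ k' = j) (hi' : g ≫ l' = i) :
    vcomp (vcomp α β hk hl) γ hj hi = vcomp α (vcomp β γ hk' hl') hj' hi' := by
  subst hk hl hk' hl' hj' hi'
  exact vcomp_assoc α β γ

theorem hcomp_vcomp' {x y z x' y' z' x'' y'' z'' : D} {f : x ⟶ x'} {g : y ⟶ y'} {h : z ⟶ z'}
    {f' : x' ⟶ x''} {g' : y' ⟶ y''} {h' : z' ⟶ z''} {i : x ⟶ x''} {j : y ⟶ y''} {k : z ⟶ z''}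
    {m : Pro x y} {n : Pro y z} {m' : Pro x' y'} {n' : Pro y' z'}
    {m'' : Pro x'' y''} {n'' : Pro y'' z''}
    (α : Cell f g m m') (β : Cell g h n n') (α' : Cell f' g' m' m'') (β' : Cell g' h' n' n'')
    (hi : f ≫ f' = i) (hj : g ≫ g' = j) (hk : h ≫ h' = k) :
    hcomp (vcomp α α' hi hj) (vcomp β β' hj hk) = vcomp (hcomp α β) (hcomp α' β') hi hk := by
  subst hi hj hk
  exact hcomp_vcomp α β α' β'

theorem gcomp_assoc {x y : D} {m n p q : Pro x y} (α : GCell m n) (β : GCell n p) (γ : GCell p q) :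
    gcomp (gcomp α β) γ = gcomp α (gcomp β γ) :=
  vcomp_assoc' ..

theorem vid_gcomp {x y : D} {m n : Pro x y} (α : GCell m n) : gcomp (vid m) α = α :=
  vid_vcomp α

theorem gcomp_vid {x y : D} {m n : Pro x y} (α : GCell m n) : gcomp α (vid n) = α :=
  vcomp_vid α

theorem hcomp_gcomp {x y z : D} {m m' m'' : Pro x y} {n n' n'' : Pro y z}
    (α : GCell m m') (β : GCell n n') (α' : GCell m' m'') (β' : GCell n' n'') :
    hcomp (gcomp α α') (gcomp β β') = gcomp (hcomp α β) (hcomp α' β') :=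
  hcomp_vcomp' ..

end Cells

section Companions

variable {D : Type u} [DoubleCategory.{w, t, v} D]

/-- A companion of an arrow `f : x ⟶ y`. -/
structure Companion {x y : D} (f : x ⟶ y) where
  pro : Pro x y
  unit : Cell (𝟙 x) f (pid x) pro
  counit : Cell f (𝟙 y) pro (pid y)
  unit_hcomp_counit :
    gcomp (gcomp (lunitInv pro) (hcomp unit counit)) (runit pro) = vid pro
  unit_vcomp_counit : vcomp unit counit (Category.id_comp f) (Category.comp_id f) = hid f

/-- Sliding: the globular cell `α_! : m ⊙ g_! ⟶ f_! ⊙ n` obtained from a cell `α` by pasting it with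
the unit of `f_!` on the left and the counit of `g_!` on the right. -/
def slide {x y x' y' : D} {f : x ⟶ x'} {g : y ⟶ y'} {m : Pro x y} {n : Pro x' y'}
    (cf : Companion f) (cg : Companion g) (α : Cell f g m n) :
    GCell (pcomp m cg.pro) (pcomp cf.pro n) :=
  gcomp (gcomp (lunitInv (pcomp m cg.pro)) (hcomp cf.unit (hcomp α cg.counit)))
    (hcomp (vid cf.pro) (runit n))

/-- A cell is a commuter (with respect to chosen companions of its left and right arrows) if
sliding turns it into an invertible globular cell. -/
def IsCommuter {x y x' y' : D} {f : x ⟶ x'} {g : y ⟶ y'} {m : Pro x y} {n : Pro x' y'}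
    (cf : Companion f) (cg : Companion g) (α : Cell f g m n) : Prop :=
  IsInvertible (slide cf cg α)

end Companions

end DoubleCategory

open DoubleCategory

section Functors

variable {C : Type u} [DoubleCategory.{w, t, v} C] {D : Type u₁} [DoubleCategory.{w₁, t₁, v₁} D]
  {E : Type u₂} [DoubleCategory.{w₂, t₂, v₂} E]

/-- The part of a double functor that does not mention external composition: a functor between the
categories of arrows, and a functor between the categories of proarrows and cells, compatible with
sources and targets. -/
structure DoubleFunctorBase (D : Type u₁) [DoubleCategory.{w₁, t₁, v₁} D]
    (E : Type u₂) [DoubleCategory.{w₂, t₂, v₂} E] extends D ⥤ E where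
  mapPro : ∀ {x y : D}, Pro x y → Pro (obj x) (obj y)
  mapCell : ∀ {x y x' y' : D} {f : x ⟶ x'} {g : y ⟶ y'} {m : Pro x y} {n : Pro x' y'},
    Cell f g m n → Cell (map f) (map g) (mapPro m) (mapPro n)
  mapCell_vid : ∀ {x y : D} (m : Pro x y),
    castCell (map_id x) (map_id y) (mapCell (vid m)) = vid (mapPro m)
  mapCell_vcomp : ∀ {x y x' y' x'' y'' : D} {f : x ⟶ x'} {f' : x' ⟶ x''}
    {g : y ⟶ y'} {g' : y' ⟶ y''} {m : Pro x y} {n : Pro x' y'} {p : Pro x'' y''}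
    (α : Cell f g m n) (β : Cell f' g' n p),
    mapCell (vcomp α β rfl rfl) =
      vcomp (mapCell α) (mapCell β) (map_comp f f').symm (map_comp g g').symm

namespace DoubleFunctorBase

/-- The action on globular cells. -/
def mapGlob (P : DoubleFunctorBase D E) {x y : D} {m n : Pro x y} (α : GCell m n) :
    GCell (P.mapPro m) (P.mapPro n) :=
  castCell (P.map_id x) (P.map_id y) (P.mapCell α)

/-- The identity. -/
protected abbrev id (D : Type u₁) [DoubleCategory.{w₁, t₁, v₁} D] : DoubleFunctorBase D D where
  obj x := x
  map f := f
  mapPro m := m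
  mapCell α := α
  mapCell_vid _ := rfl
  mapCell_vcomp _ _ := rfl

theorem mapCell_castCell (P : DoubleFunctorBase D E) {x y x' y' : D} {f f' : x ⟶ x'}
    {g g' : y ⟶ y'} {m : Pro x y} {n : Pro x' y'} (hf : f = f') (hg : g = g') (α : Cell f g m n) :
    P.mapCell (castCell hf hg α) =
      castCell (congrArg P.map hf) (congrArg P.map hg) (P.mapCell α) := by
  subst hf hg
  rfl

theorem mapCell_vcomp' (P : DoubleFunctorBase D E) {x y x' y' x'' y'' : D} {f : x ⟶ x'}
    {f' : x' ⟶ x''} {g : y ⟶ y'} {g' : y' ⟶ y''} {k : x ⟶ x''} {l : y ⟶ y''}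
    {m : Pro x y} {n : Pro x' y'} {p : Pro x'' y''}
    (α : Cell f g m n) (β : Cell f' g' n p) (hk : f ≫ f' = k) (hl : g ≫ g' = l) :
    P.mapCell (vcomp α β hk hl) = vcomp (P.mapCell α) (P.mapCell β)
      ((P.map_comp f f').symm.trans (congrArg P.map hk))
      ((P.map_comp g g').symm.trans (congrArg P.map hl)) := by
  subst hk hl
  exact P.mapCell_vcomp α β

theorem mapGlob_vid (P : DoubleFunctorBase D E) {x y : D} (m : Pro x y) :
    P.mapGlob (vid m) = vid (P.mapPro m) :=
  P.mapCell_vid m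

theorem mapGlob_gcomp (P : DoubleFunctorBase D E) {x y : D} {m n p : Pro x y}
    (α : GCell m n) (β : GCell n p) :
    P.mapGlob (gcomp α β) = gcomp (P.mapGlob α) (P.mapGlob β) := by
  simp only [mapGlob, mapCell_vcomp', castCell_vcomp, vcomp_castCell, castCell_vcomp_left]

/-- The composite of `P` followed by `Q`. -/
protected abbrev comp (P : DoubleFunctorBase C D) (Q : DoubleFunctorBase D E) :
    DoubleFunctorBase C E where
  obj x := Q.obj (P.obj x)
  map f := Q.map (P.map f)
  mapPro m := Q.mapPro (P.mapPro m)
  mapCell α := Q.mapCell (P.mapCell α)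
  mapCell_vid m := by
    have h := Q.mapCell_vid (P.mapPro m)
    rw [← P.mapCell_vid m, mapCell_castCell, castCell_castCell] at h
    exact h
  mapCell_vcomp α β := by
    rw [P.mapCell_vcomp, Q.mapCell_vcomp']

theorem comp_mapGlob (P : DoubleFunctorBase C D) (Q : DoubleFunctorBase D E) {x y : C}
    {m n : Pro x y} (α : GCell m n) :
    (P.comp Q).mapGlob α = Q.mapGlob (P.mapGlob α) := by
  simp only [mapGlob, mapCell_castCell, castCell_castCell]

end DoubleFunctorBase

/-- A (pseudo) double functor. -/
structure DoubleFunctor (D : Type u₁) [DoubleCategory.{w₁, t₁, v₁} D]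
    (E : Type u₂) [DoubleCategory.{w₂, t₂, v₂} E] extends DoubleFunctorBase D E where
  /-- The comparison cells `F_{m,n} : Fm ⊙ Fn ⟶ F(m ⊙ n)` and their inverses. -/
  mapComp : ∀ {x y z : D} (m : Pro x y) (n : Pro y z),
    GCell (pcomp (mapPro m) (mapPro n)) (mapPro (pcomp m n))
  mapCompInv : ∀ {x y z : D} (m : Pro x y) (n : Pro y z),
    GCell (mapPro (pcomp m n)) (pcomp (mapPro m) (mapPro n))
  mapComp_mapCompInv : ∀ {x y z : D} (m : Pro x y) (n : Pro y z),
    gcomp (mapComp m n) (mapCompInv m n) = vid _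
  mapCompInv_mapComp : ∀ {x y z : D} (m : Pro x y) (n : Pro y z),
    gcomp (mapCompInv m n) (mapComp m n) = vid _
  /-- The comparison cells `F_x : id_{Fx} ⟶ F(id_x)` and their inverses. -/
  mapId : ∀ x : D, GCell (pid (obj x)) (mapPro (pid x))
  mapIdInv : ∀ x : D, GCell (mapPro (pid x)) (pid (obj x))
  mapId_mapIdInv : ∀ x : D, gcomp (mapId x) (mapIdInv x) = vid _
  mapIdInv_mapId : ∀ x : D, gcomp (mapIdInv x) (mapId x) = vid _
  mapComp_naturality : ∀ {x y z x' y' z' : D} {f : x ⟶ x'} {g : y ⟶ y'} {h : z ⟶ z'}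
    {m : Pro x y} {n : Pro y z} {m' : Pro x' y'} {n' : Pro y' z'}
    (α : Cell f g m m') (β : Cell g h n n'),
    vcomp (hcomp (mapCell α) (mapCell β)) (mapComp m' n') (Category.comp_id _) (Category.comp_id _) =
      vcomp (mapComp m n) (mapCell (hcomp α β)) (Category.id_comp _) (Category.id_comp _)
  mapId_naturality : ∀ {x y : D} (f : x ⟶ y),
    vcomp (hid (map f)) (mapId y) (Category.comp_id _) (Category.comp_id _) =
      vcomp (mapId x) (mapCell (hid f)) (Category.id_comp _) (Category.id_comp _)
  map_assoc : ∀ {a b c d : D} (m : Pro a b) (n : Pro b c) (p : Pro c d),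
    gcomp (gcomp (hcomp (mapComp m n) (vid (mapPro p))) (mapComp (pcomp m n) p))
        (toDoubleFunctorBase.mapGlob (associator m n p)) =
      gcomp (gcomp (associator (mapPro m) (mapPro n) (mapPro p))
        (hcomp (vid (mapPro m)) (mapComp n p))) (mapComp m (pcomp n p))
  map_lunit : ∀ {x y : D} (m : Pro x y),
    gcomp (gcomp (hcomp (mapId x) (vid (mapPro m))) (mapComp (pid x) m))
      (toDoubleFunctorBase.mapGlob (lunit m)) = lunit (mapPro m)
  map_runit : ∀ {x y : D} (m : Pro x y),
    gcomp (gcomp (hcomp (vid (mapPro m)) (mapId y)) (mapComp m (pid y)))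
      (toDoubleFunctorBase.mapGlob (runit m)) = runit (mapPro m)

namespace DoubleFunctor

theorem mapComp_mapGlob (F : DoubleFunctor D E) {x y z : D} {m m' : Pro x y} {n n' : Pro y z}
    (α : GCell m m') (β : GCell n n') :
    gcomp (hcomp (F.mapGlob α) (F.mapGlob β)) (F.mapComp m' n') =
      gcomp (F.mapComp m n) (F.mapGlob (hcomp α β)) := by
  have h := F.mapComp_naturality α β
  have key : ∀ {f : F.obj x ⟶ F.obj x} {g : F.obj y ⟶ F.obj y} {k : F.obj z ⟶ F.obj z}
      (hf : f = 𝟙 _) (hg : g = 𝟙 _) (hk : k = 𝟙 _)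
      (a : Cell f g (F.mapPro m) (F.mapPro m')) (b : Cell g k (F.mapPro n) (F.mapPro n'))
      (c : Cell f k (F.mapPro (pcomp m n)) (F.mapPro (pcomp m' n'))),
      vcomp (hcomp a b) (F.mapComp m' n') (Category.comp_id _) (Category.comp_id _) =
        vcomp (F.mapComp m n) c (Category.id_comp _) (Category.id_comp _) →
      gcomp (hcomp (castCell hf hg a) (castCell hg hk b)) (F.mapComp m' n') =
        gcomp (F.mapComp m n) (castCell hf hk c) := by
    intro f g k hf hg hk a b c h
    subst hf hg hk
    exact h
  exact key _ _ _ _ _ _ h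

/-- The identity double functor. -/
protected abbrev id (D : Type u₁) [DoubleCategory.{w₁, t₁, v₁} D] : DoubleFunctor D D where
  toDoubleFunctorBase := DoubleFunctorBase.id D
  mapComp m n := vid (pcomp m n)
  mapCompInv m n := vid (pcomp m n)
  mapComp_mapCompInv _ _ := vid_vcomp _
  mapCompInv_mapComp _ _ := vid_vcomp _
  mapId x := vid (pid x)
  mapIdInv x := vid (pid x)
  mapId_mapIdInv _ := vid_vcomp _
  mapIdInv_mapId _ := vid_vcomp _
  mapComp_naturality α β := (vcomp_vid _).trans (vid_vcomp _).symm
  mapId_naturality f := (vcomp_vid _).trans (vid_vcomp _).symm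
  map_assoc m n p := by
    change gcomp (gcomp (hcomp (vid (pcomp m n)) (vid p)) (vid (pcomp (pcomp m n) p)))
        (associator m n p) =
      gcomp (gcomp (associator m n p) (hcomp (vid m) (vid (pcomp n p)))) (vid (pcomp m (pcomp n p)))
    simp only [hcomp_vid, vid_gcomp, gcomp_vid]
  map_lunit m := by
    change gcomp (gcomp (hcomp (vid (pid _)) (vid m)) (vid (pcomp (pid _) m))) (lunit m) = lunit m
    simp only [hcomp_vid, vid_gcomp]
  map_runit m := by
    change gcomp (gcomp (hcomp (vid m) (vid (pid _))) (vid (pcomp m (pid _)))) (runit m) = runit m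
    simp only [hcomp_vid, vid_gcomp]

/-- The composite of `F` followed by `G`. -/
protected abbrev comp (F : DoubleFunctor C D) (G : DoubleFunctor D E) : DoubleFunctor C E where
  toDoubleFunctorBase := F.toDoubleFunctorBase.comp G.toDoubleFunctorBase
  mapComp m n := gcomp (G.mapComp (F.mapPro m) (F.mapPro n)) (G.mapGlob (F.mapComp m n))
  mapCompInv m n := gcomp (G.mapGlob (F.mapCompInv m n)) (G.mapCompInv (F.mapPro m) (F.mapPro n))
  mapComp_mapCompInv m n := by
    rw [gcomp_assoc, ← gcomp_assoc (G.mapGlob _), ← DoubleFunctorBase.mapGlob_gcomp,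
      F.mapComp_mapCompInv, DoubleFunctorBase.mapGlob_vid, vid_gcomp, G.mapComp_mapCompInv]
  mapCompInv_mapComp m n := by
    rw [gcomp_assoc, ← gcomp_assoc (G.mapCompInv _ _), G.mapCompInv_mapComp, vid_gcomp,
      ← DoubleFunctorBase.mapGlob_gcomp, F.mapCompInv_mapComp, DoubleFunctorBase.mapGlob_vid]
  mapId x := gcomp (G.mapId (F.obj x)) (G.mapGlob (F.mapId x))
  mapIdInv x := gcomp (G.mapGlob (F.mapIdInv x)) (G.mapIdInv (F.obj x))
  mapId_mapIdInv x := by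
    rw [gcomp_assoc, ← gcomp_assoc (G.mapGlob _), ← DoubleFunctorBase.mapGlob_gcomp,
      F.mapId_mapIdInv, DoubleFunctorBase.mapGlob_vid, vid_gcomp, G.mapId_mapIdInv]
  mapIdInv_mapId x := by
    rw [gcomp_assoc, ← gcomp_assoc (G.mapIdInv _), G.mapIdInv_mapId, vid_gcomp,
      ← DoubleFunctorBase.mapGlob_gcomp, F.mapIdInv_mapId, DoubleFunctorBase.mapGlob_vid]
  mapComp_naturality {_ _ _ _ _ _ f g h m n m' n'} α β := by
    have h₁ := G.mapComp_naturality (F.mapCell α) (F.mapCell β)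
    have h₂ := congrArg G.mapCell (F.mapComp_naturality α β)
    rw [DoubleFunctorBase.mapCell_vcomp', DoubleFunctorBase.mapCell_vcomp'] at h₂
    change vcomp (hcomp (G.mapCell (F.mapCell α)) (G.mapCell (F.mapCell β)))
        (gcomp (G.mapComp (F.mapPro m') (F.mapPro n')) (G.mapGlob (F.mapComp m' n')))
        (Category.comp_id (G.map (F.map f))) (Category.comp_id (G.map (F.map h))) =
      vcomp (gcomp (G.mapComp (F.mapPro m) (F.mapPro n)) (G.mapGlob (F.mapComp m n)))
        (G.mapCell (F.mapCell (hcomp α β)))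
        (Category.id_comp (G.map (F.map f))) (Category.id_comp (G.map (F.map h)))
    rw [← vcomp_assoc' _ _ _ (Category.comp_id _) (Category.comp_id _) (Category.comp_id _)
      (Category.comp_id _), h₁]
    rw [vcomp_assoc' _ _ _ _ _ _ _ (Category.comp_id _) (Category.comp_id _) (Category.id_comp _)
      (Category.id_comp _), vcomp_assoc' _ _ _ _ _ _ _ (Category.id_comp _) (Category.id_comp _)
      (Category.id_comp _) (Category.id_comp _)]
    unfold DoubleFunctorBase.mapGlob
    rw [vcomp_castCell, castCell_vcomp_left, h₂]
  mapId_naturality {x y} f := by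
    have h₁ := G.mapId_naturality (F.map f)
    have h₂ := congrArg G.mapCell (F.mapId_naturality f)
    rw [DoubleFunctorBase.mapCell_vcomp', DoubleFunctorBase.mapCell_vcomp'] at h₂
    change vcomp (hid (G.map (F.map f)))
        (gcomp (G.mapId (F.obj y)) (G.mapGlob (F.mapId y)))
        (Category.comp_id (G.map (F.map f))) (Category.comp_id (G.map (F.map f))) =
      vcomp (gcomp (G.mapId (F.obj x)) (G.mapGlob (F.mapId x)))
        (G.mapCell (F.mapCell (hid f)))
        (Category.id_comp (G.map (F.map f))) (Category.id_comp (G.map (F.map f)))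
    rw [← vcomp_assoc' _ _ _ (Category.comp_id _) (Category.comp_id _) (Category.comp_id _)
      (Category.comp_id _), h₁]
    rw [vcomp_assoc' _ _ _ _ _ _ _ (Category.comp_id _) (Category.comp_id _) (Category.id_comp _)
      (Category.id_comp _), vcomp_assoc' _ _ _ _ _ _ _ (Category.id_comp _) (Category.id_comp _)
      (Category.id_comp _) (Category.id_comp _)]
    unfold DoubleFunctorBase.mapGlob
    rw [vcomp_castCell, castCell_vcomp_left, h₂]
  map_assoc m n p := by
    rw [DoubleFunctorBase.comp_mapGlob]
    change gcomp (gcomp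
        (hcomp (gcomp (G.mapComp (F.mapPro m) (F.mapPro n)) (G.mapGlob (F.mapComp m n)))
          (vid (G.mapPro (F.mapPro p))))
        (gcomp (G.mapComp (F.mapPro (pcomp m n)) (F.mapPro p)) (G.mapGlob (F.mapComp (pcomp m n) p))))
        (G.mapGlob (F.mapGlob (associator m n p))) =
      gcomp (gcomp (associator (G.mapPro (F.mapPro m)) (G.mapPro (F.mapPro n))
          (G.mapPro (F.mapPro p)))
        (hcomp (vid (G.mapPro (F.mapPro m)))
          (gcomp (G.mapComp (F.mapPro n) (F.mapPro p)) (G.mapGlob (F.mapComp n p)))))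
        (gcomp (G.mapComp (F.mapPro m) (F.mapPro (pcomp n p))) (G.mapGlob (F.mapComp m (pcomp n p))))
    have h₁ : hcomp (gcomp (G.mapComp (F.mapPro m) (F.mapPro n)) (G.mapGlob (F.mapComp m n)))
          (vid (G.mapPro (F.mapPro p))) =
        gcomp (hcomp (G.mapComp (F.mapPro m) (F.mapPro n)) (vid (G.mapPro (F.mapPro p))))
          (hcomp (G.mapGlob (F.mapComp m n)) (G.mapGlob (vid (F.mapPro p)))) := by
      rw [← hcomp_gcomp, DoubleFunctorBase.mapGlob_vid, gcomp_vid]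
    have h₂ : hcomp (vid (G.mapPro (F.mapPro m)))
          (gcomp (G.mapComp (F.mapPro n) (F.mapPro p)) (G.mapGlob (F.mapComp n p))) =
        gcomp (hcomp (vid (G.mapPro (F.mapPro m))) (G.mapComp (F.mapPro n) (F.mapPro p)))
          (hcomp (G.mapGlob (vid (F.mapPro m))) (G.mapGlob (F.mapComp n p))) := by
      rw [← hcomp_gcomp, DoubleFunctorBase.mapGlob_vid, gcomp_vid]
    have h₃ := congrArg G.mapGlob (F.map_assoc m n p)
    simp only [DoubleFunctorBase.mapGlob_gcomp] at h₃
    have h₄ := G.map_assoc (F.mapPro m) (F.mapPro n) (F.mapPro p)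
    rw [h₁, h₂, gcomp_assoc, gcomp_assoc, ← gcomp_assoc (hcomp (G.mapGlob _) _),
      ← gcomp_assoc (hcomp (G.mapGlob _) _), G.mapComp_mapGlob]
    simp only [gcomp_assoc] at h₃ h₄ ⊢
    rw [h₃, ← gcomp_assoc (G.mapComp _ _), ← gcomp_assoc (hcomp (G.mapComp _ _) _), h₄,
      ← gcomp_assoc (hcomp (G.mapGlob _) _), G.mapComp_mapGlob]
    simp only [gcomp_assoc]
  map_lunit {x y} m := by
    rw [DoubleFunctorBase.comp_mapGlob]
    have h₁ : hcomp (gcomp (G.mapId (F.obj x)) (G.mapGlob (F.mapId x)))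
          (vid (G.mapPro (F.mapPro m))) =
        gcomp (hcomp (G.mapId (F.obj x)) (vid (G.mapPro (F.mapPro m))))
          (hcomp (G.mapGlob (F.mapId x)) (G.mapGlob (vid (F.mapPro m)))) := by
      rw [← hcomp_gcomp, DoubleFunctorBase.mapGlob_vid, gcomp_vid]
    rw [h₁, ← G.map_lunit, ← F.map_lunit, DoubleFunctorBase.mapGlob_gcomp,
      DoubleFunctorBase.mapGlob_gcomp]
    simp only [gcomp_assoc]
    rw [← gcomp_assoc (hcomp (G.mapGlob _) _), G.mapComp_mapGlob, gcomp_assoc]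
  map_runit {x y} m := by
    rw [DoubleFunctorBase.comp_mapGlob]
    have h₁ : hcomp (vid (G.mapPro (F.mapPro m)))
          (gcomp (G.mapId (F.obj y)) (G.mapGlob (F.mapId y))) =
        gcomp (hcomp (vid (G.mapPro (F.mapPro m))) (G.mapId (F.obj y)))
          (hcomp (G.mapGlob (vid (F.mapPro m))) (G.mapGlob (F.mapId y))) := by
      rw [← hcomp_gcomp, DoubleFunctorBase.mapGlob_vid, gcomp_vid]
    rw [h₁, ← G.map_runit, ← F.map_runit, DoubleFunctorBase.mapGlob_gcomp,
      DoubleFunctorBase.mapGlob_gcomp]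
    simp only [gcomp_assoc]
    rw [← gcomp_assoc (hcomp (G.mapGlob _) _), G.mapComp_mapGlob, gcomp_assoc]

end DoubleFunctor

/-- A natural transformation between `P` and `Q`: arrows `α_x : Px ⟶ Qx` natural in `x`, and cells
`α_m`, with left and right arrows `α_x` and `α_y`, natural in the proarrow `m : x ⇸ y`. -/
structure DoubleNatTransBase (P Q : DoubleFunctorBase D E) where
  app : ∀ x : D, P.obj x ⟶ Q.obj x
  naturality : ∀ {x y : D} (f : x ⟶ y), P.map f ≫ app y = app x ≫ Q.map f
  appPro : ∀ {x y : D} (m : Pro x y), Cell (app x) (app y) (P.mapPro m) (Q.mapPro m)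
  naturality_cell : ∀ {x y x' y' : D} {f : x ⟶ x'} {g : y ⟶ y'} {m : Pro x y} {n : Pro x' y'}
    (γ : Cell f g m n),
    vcomp (P.mapCell γ) (appPro n) (naturality f) (naturality g) =
      vcomp (appPro m) (Q.mapCell γ) rfl rfl

/-- The identity natural transformation. -/
protected abbrev DoubleNatTransBase.id (P : DoubleFunctorBase D E) : DoubleNatTransBase P P where
  app x := 𝟙 (P.obj x)
  naturality f := (Category.comp_id _).trans (Category.id_comp _).symm
  appPro m := vid (P.mapPro m)
  naturality_cell {_ _ _ _ f g m n} γ := by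
    rw [← castCell_vcomp (P.mapCell γ) (vid (P.mapPro n)) (Category.comp_id _) (Category.comp_id _)
      (Category.id_comp _).symm (Category.id_comp _).symm, vcomp_vid]
    conv_lhs => rw [← vid_vcomp (P.mapCell γ)]
    rw [castCell_vcomp]

/-- A (tight) natural transformation between double functors. -/
structure DoubleNatTrans (F G : DoubleFunctor D E) extends
    DoubleNatTransBase F.toDoubleFunctorBase G.toDoubleFunctorBase where
  app_pcomp : ∀ {x y z : D} (m : Pro x y) (n : Pro y z),
    vcomp (hcomp (appPro m) (appPro n)) (G.mapComp m n)
        (Category.comp_id _) (Category.comp_id _) =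
      vcomp (F.mapComp m n) (appPro (pcomp m n)) (Category.id_comp _) (Category.id_comp _)
  app_pid : ∀ x : D,
    vcomp (hid (app x)) (G.mapId x) (Category.comp_id _) (Category.comp_id _) =
      vcomp (F.mapId x) (appPro (pid x)) (Category.id_comp _) (Category.id_comp _)

/-- A double adjunction `F ⊣ G` between double functors, i.e. an adjunction in the 2-category of
double categories, double functors and natural transformations. The triangle identities hold
strictly; they are equations between natural transformations `F ⟹ F` and `G ⟹ G`, stated for the
components at objects and at proarrows. -/
structure DoubleAdjunction (F : DoubleFunctor D E) (G : DoubleFunctor E D) where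
  unit : DoubleNatTrans (DoubleFunctor.id D) (F.comp G)
  counit : DoubleNatTrans (G.comp F) (DoubleFunctor.id E)
  left_triangle : ∀ x : D, F.map (unit.app x) ≫ counit.app (F.obj x) = 𝟙 (F.obj x)
  left_triangle_pro : ∀ {x y : D} (m : Pro x y),
    vcomp (F.mapCell (unit.appPro m)) (counit.appPro (F.mapPro m))
      (left_triangle x) (left_triangle y) = vid (F.mapPro m)
  right_triangle : ∀ y : E, unit.app (G.obj y) ≫ G.map (counit.app y) = 𝟙 (G.obj y)
  right_triangle_pro : ∀ {x y : E} (m : Pro x y),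
    vcomp (unit.appPro (G.mapPro m)) (G.mapCell (counit.appPro m))
      (right_triangle x) (right_triangle y) = vid (G.mapPro m)

/-- The components of an oplax protransformation, without the axioms: proarrows `τ_x`, cells `τ_f`
and naturality comparisons `τ_m : Pm ⊙ τ_y ⟶ τ_x ⊙ Qm`. -/
structure OplaxProtransData (P Q : DoubleFunctorBase D E) where
  app : ∀ x : D, Pro (P.obj x) (Q.obj x)
  appArrow : ∀ {x y : D} (f : x ⟶ y), Cell (P.map f) (Q.map f) (app x) (app y)
  appPro : ∀ {x y : D} (m : Pro x y),
    GCell (pcomp (P.mapPro m) (app y)) (pcomp (app x) (Q.mapPro m))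

/-- An oplax protransformation between double functors. -/
structure OplaxProtrans (F G : DoubleFunctor D E) extends
    OplaxProtransData F.toDoubleFunctorBase G.toDoubleFunctorBase where
  appArrow_id : ∀ x : D, castCell (F.map_id x) (G.map_id x) (appArrow (𝟙 x)) = vid (app x)
  appArrow_comp : ∀ {x y z : D} (f : x ⟶ y) (g : y ⟶ z),
    appArrow (f ≫ g) =
      vcomp (appArrow f) (appArrow g) (F.map_comp f g).symm (G.map_comp f g).symm
  /-- Naturality with respect to cells. -/
  naturality : ∀ {x y x' y' : D} {f : x ⟶ x'} {g : y ⟶ y'} {m : Pro x y} {n : Pro x' y'}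
    (γ : Cell f g m n),
    vcomp (appPro m) (hcomp (appArrow f) (G.mapCell γ)) (Category.id_comp _) (Category.id_comp _) =
      vcomp (hcomp (F.mapCell γ) (appArrow g)) (appPro n) (Category.comp_id _) (Category.comp_id _)
  /-- Coherence with respect to external composition. -/
  appPro_pcomp : ∀ {x y z : D} (m : Pro x y) (n : Pro y z),
    gcomp (hcomp (F.mapComp m n) (vid (app z))) (appPro (pcomp m n)) =
      gcomp (gcomp (gcomp (gcomp (gcomp
        (associator (F.mapPro m) (F.mapPro n) (app z))
        (hcomp (vid (F.mapPro m)) (appPro n)))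
        (associatorInv (F.mapPro m) (app y) (G.mapPro n)))
        (hcomp (appPro m) (vid (G.mapPro n))))
        (associator (app x) (G.mapPro m) (G.mapPro n)))
        (hcomp (vid (app x)) (G.mapComp m n))
  /-- Coherence with respect to external identities. -/
  appPro_pid : ∀ x : D,
    gcomp (hcomp (F.mapId x) (vid (app x))) (appPro (pid x)) =
      gcomp (gcomp (lunit (app x)) (runitInv (app x))) (hcomp (vid (app x)) (G.mapId x))

/-- An oplax protransformation is a (pseudo) protransformation if all its naturality comparisons
are invertible. -/
def OplaxProtrans.IsPseudo {F G : DoubleFunctor D E} (τ : OplaxProtrans F G) : Prop :=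
  ∀ {x y : D} (m : Pro x y), IsInvertible (τ.appPro m)

namespace OplaxProtransData

/-- The identity protransformation. -/
protected abbrev id (P : DoubleFunctorBase D E) : OplaxProtransData P P where
  app x := pid (P.obj x)
  appArrow f := hid (P.map f)
  appPro m := gcomp (runit (P.mapPro m)) (lunitInv (P.mapPro m))

/-- The external composite `σ ⊙ τ`. -/
protected abbrev comp {P Q R : DoubleFunctorBase D E} (σ : OplaxProtransData P Q)
    (τ : OplaxProtransData Q R) : OplaxProtransData P R where
  app x := pcomp (σ.app x) (τ.app x)
  appArrow f := hcomp (σ.appArrow f) (τ.appArrow f)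
  appPro {x y} m :=
    gcomp (gcomp (gcomp (gcomp
      (associatorInv (P.mapPro m) (σ.app y) (τ.app y))
      (hcomp (σ.appPro m) (vid (τ.app y))))
      (associator (σ.app x) (Q.mapPro m) (τ.app y)))
      (hcomp (vid (σ.app x)) (τ.appPro m)))
      (associatorInv (σ.app x) (τ.app x) (R.mapPro m))

/-- The pre-whiskering `τ * P`. -/
protected abbrev preWhisker (P : DoubleFunctorBase C D) {Q R : DoubleFunctorBase D E}
    (τ : OplaxProtransData Q R) : OplaxProtransData (P.comp Q) (P.comp R) where
  app x := τ.app (P.obj x)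
  appArrow f := τ.appArrow (P.map f)
  appPro m := τ.appPro (P.mapPro m)

/-- The post-whiskering `H * τ` with a double functor `H`. -/
protected abbrev postWhisker {P Q : DoubleFunctorBase C D} (τ : OplaxProtransData P Q)
    (H : DoubleFunctor D E) :
    OplaxProtransData (P.comp H.toDoubleFunctorBase) (Q.comp H.toDoubleFunctorBase) where
  app x := H.mapPro (τ.app x)
  appArrow f := H.mapCell (τ.appArrow f)
  appPro {x y} m :=
    gcomp (gcomp (H.mapComp (P.mapPro m) (τ.app y)) (H.mapGlob (τ.appPro m)))
      (H.mapCompInv (τ.app x) (Q.mapPro m))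

end OplaxProtransData

/-- A modification bounded by natural transformations `α`, `β` and oplax protransformations
`σ`, `τ`. -/
structure Modification {P Q R S : DoubleFunctorBase D E} (α : DoubleNatTransBase P R)
    (β : DoubleNatTransBase Q S) (σ : OplaxProtransData P Q) (τ : OplaxProtransData R S) where
  app : ∀ x : D, Cell (α.app x) (β.app x) (σ.app x) (τ.app x)
  /-- Internal equivariance. -/
  app_arrow : ∀ {x y : D} (f : x ⟶ y),
    vcomp (σ.appArrow f) (app y) (α.naturality f) (β.naturality f) =
      vcomp (app x) (τ.appArrow f) rfl rfl
  /-- External equivariance. -/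
  app_pro : ∀ {x y : D} (m : Pro x y),
    vcomp (σ.appPro m) (hcomp (app x) (β.appPro m)) (Category.id_comp _) (Category.id_comp _) =
      vcomp (hcomp (α.appPro m) (app y)) (τ.appPro m) (Category.comp_id _) (Category.comp_id _)

/-- A globular modification, i.e. one bounded by identity natural transformations. -/
abbrev GModification {P Q : DoubleFunctorBase D E} (σ τ : OplaxProtransData P Q) :=
  Modification (DoubleNatTransBase.id P) (DoubleNatTransBase.id Q) σ τ

/-- An invertible globular modification. -/
structure InvertibleModification {P Q : DoubleFunctorBase D E} (σ τ : OplaxProtransData P Q) where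
  hom : GModification σ τ
  inv : GModification τ σ
  hom_inv : ∀ x : D, gcomp (hom.app x) (inv.app x) = vid (σ.app x)
  inv_hom : ∀ x : D, gcomp (inv.app x) (hom.app x) = vid (τ.app x)

/-- `ProtransCompanion α τ` exhibits the oplax protransformation `τ` as a companion of the natural
transformation `α` in the double category of double functors `D → E`, natural transformations,
oplax protransformations and modifications. In that double category the composites and the unitors
are formed componentwise. -/
structure ProtransCompanion {F G : DoubleFunctor D E} (α : DoubleNatTrans F G)
    (τ : OplaxProtrans F G) where
  unit : Modification (DoubleNatTransBase.id F.toDoubleFunctorBase) α.toDoubleNatTransBase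
    (OplaxProtransData.id F.toDoubleFunctorBase) τ.toOplaxProtransData
  counit : Modification α.toDoubleNatTransBase (DoubleNatTransBase.id G.toDoubleFunctorBase)
    τ.toOplaxProtransData (OplaxProtransData.id G.toDoubleFunctorBase)
  unit_hcomp_counit : ∀ x : D,
    gcomp (gcomp (lunitInv (τ.app x)) (hcomp (unit.app x) (counit.app x))) (runit (τ.app x)) =
      vid (τ.app x)
  unit_vcomp_counit : ∀ x : D,
    vcomp (unit.app x) (counit.app x) (Category.id_comp _) (Category.comp_id _) = hid (α.app x)

/-- The companion of the component arrow `α_x` underlying a companion of `α`. -/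
def ProtransCompanion.companion {F G : DoubleFunctor D E} {α : DoubleNatTrans F G}
    {τ : OplaxProtrans F G} (K : ProtransCompanion α τ) (x : D) : Companion (α.app x) where
  pro := τ.app x
  unit := K.unit.app x
  counit := K.counit.app x
  unit_hcomp_counit := K.unit_hcomp_counit x
  unit_vcomp_counit := K.unit_vcomp_counit x

/-- A lax adjunction `(u, e, s, t) : F ⊣ G` consisting of double functors, oplax
protransformations `u : 1 ⇸ GF` and `e : FG ⇸ 1`, and invertible modifications
`s : 1_F ⟶ (F * u) ⊙ (e * F)` and `t : (u * G) ⊙ (G * e) ⟶ 1_G`, subject to the two swallowtail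
identities. The swallowtail pastings are oriented along the naturality comparisons of the oplax
protransformations, `u_{u_x} : u_x ⊙ u_{GFx} ⟶ u_x ⊙ GF(u_x)` and
`e_{e_y} : FG(e_y) ⊙ e_y ⟶ e_{FGy} ⊙ e_y`, hence against the directions of `s` and `t`. -/
structure LaxAdjunction (F : DoubleFunctor D E) (G : DoubleFunctor E D) where
  unit : OplaxProtrans (DoubleFunctor.id D) (F.comp G)
  counit : OplaxProtrans (G.comp F) (DoubleFunctor.id E)
  s : InvertibleModification (P := F.toDoubleFunctorBase) (Q := F.toDoubleFunctorBase)
    (OplaxProtransData.id F.toDoubleFunctorBase)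
    (OplaxProtransData.comp (unit.toOplaxProtransData.postWhisker F)
      (counit.toOplaxProtransData.preWhisker F.toDoubleFunctorBase))
  t : InvertibleModification (P := G.toDoubleFunctorBase) (Q := G.toDoubleFunctorBase)
    (OplaxProtransData.comp (unit.toOplaxProtransData.preWhisker G.toDoubleFunctorBase)
      (counit.toOplaxProtransData.postWhisker G))
    (OplaxProtransData.id G.toDoubleFunctorBase)
  swallowtail_unit : ∀ x : D,
    gcomp (gcomp (gcomp (gcomp (gcomp (gcomp
      (runitInv (unit.app x))
      (hcomp (vid (unit.app x)) (t.inv.app (F.obj x))))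
      (associatorInv (unit.app x) (unit.app (G.obj (F.obj x)))
        (G.mapPro (counit.app (F.obj x)))))
      (hcomp (unit.appPro (unit.app x)) (vid (G.mapPro (counit.app (F.obj x))))))
      (associator (unit.app x) (G.mapPro (F.mapPro (unit.app x)))
        (G.mapPro (counit.app (F.obj x)))))
      (hcomp (vid (unit.app x))
        (gcomp (gcomp (G.mapComp (F.mapPro (unit.app x)) (counit.app (F.obj x)))
          (G.mapGlob (s.inv.app x))) (G.mapIdInv (F.obj x)))))
      (runit (unit.app x)) = vid (unit.app x)
  swallowtail_counit : ∀ y : E,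
    gcomp (gcomp (gcomp (gcomp (gcomp (gcomp
      (lunitInv (counit.app y))
      (hcomp (gcomp (gcomp (F.mapId (G.obj y)) (F.mapGlob (t.inv.app y)))
          (F.mapCompInv (unit.app (G.obj y)) (G.mapPro (counit.app y))))
        (vid (counit.app y))))
      (associator (F.mapPro (unit.app (G.obj y))) (F.mapPro (G.mapPro (counit.app y)))
        (counit.app y)))
      (hcomp (vid (F.mapPro (unit.app (G.obj y)))) (counit.appPro (counit.app y))))
      (associatorInv (F.mapPro (unit.app (G.obj y))) (counit.app (F.obj (G.obj y)))
        (counit.app y)))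
      (hcomp (s.inv.app (G.obj y)) (vid (counit.app y))))
      (lunit (counit.app y)) = vid (counit.app y)

/-- A biadjunction is a lax adjunction whose unit and counit are (pseudo) protransformations. -/
structure LaxAdjunction.IsBiadjunction {F : DoubleFunctor D E} {G : DoubleFunctor E D}
    (A : LaxAdjunction F G) : Prop where
  unit_isPseudo : A.unit.IsPseudo
  counit_isPseudo : A.counit.IsPseudo

end Functors

/-! Everything rests on the universal property of a companion: a cell ending at `f_! ⊙ n` is
determined by its paste with the counit of `f_!`, and every cell whose left arrow factors through
`f` arises from exactly one such cell (`Companion.lift_lact`, `Companion.lift_vcomp_lact`,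
`Companion.lact_ext`; `Companion.counit_ext` is the uniqueness for cells ending at `f_!` itself).
Each structure cell is therefore pinned down by a counit equation, and each identity is tested after
pasting with a counit. For instance, the slide of `α` is the unique globular cell whose paste with
the counit of `f_!` is `α` pasted with the counit of `g_!` (`slide_lact`).

Under this test the axioms of the oplax protransformations `η_!` and `ε_!` become the axioms of the
natural transformations `η` and `ε` (`companionProtrans`, `protransCompanion`). Companions compose
and are preserved by double functors, so the triangle identity `F η_x ; ε_{Fx} = 1` makes `F(η_!)_x
⊙ (ε_!)_{Fx}` a companion of an identity arrow. The unit and counit of such a companion are mutually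
inverse globular cells. The unit is `s`; on the other side the counit is `t`. The triangle
identities at proarrows make these families modifications.

In a swallowtail, naturality of `η` or `ε` at the counit of its own companion lets one composite
counit replace another, so that the cells coming from `s` and `t` cancel (`swallowtail_of_counit`,
`swallowtail_of_counit'`). The comparison cell at any companion proarrow is a counit-compatible map
between two companions of one arrow, by naturality of the transformation, and hence is invertible
(`isInvertible_slide_companion`). -/

namespace DoubleCategory

/-! ### Composition of cells and the underlying globular bicategory. -/

section Calculus

variable {D : Type u} [DoubleCategory.{w, t, v} D]

/-- Precomposing with the two sides of an equation `α ; β = ω`. -/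
theorem vcomp_reassoc {x y x' y' x'' y'' x''' y''' : D}
    {f : x ⟶ x'} {f' : x' ⟶ x''} {f'' : x'' ⟶ x'''} {g : y ⟶ y'} {g' : y' ⟶ y''} {g'' : y'' ⟶ y'''}
    {k : x ⟶ x''} {l : y ⟶ y''} {k' : x' ⟶ x'''} {l' : y' ⟶ y'''} {j : x ⟶ x'''} {i : y ⟶ y'''}
    {m : Pro x y} {n : Pro x' y'} {p : Pro x'' y''} {q : Pro x''' y'''}
    {α : Cell f g m n} {β : Cell f' g' n p} {hk : f ≫ f' = k} {hl : g ≫ g' = l} {ω : Cell k l m p}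
    (h : vcomp α β hk hl = ω) (γ : Cell f'' g'' p q) (hk' : f' ≫ f'' = k') (hl' : g' ≫ g'' = l')
    (hj : f ≫ k' = j) (hi : g ≫ l' = i) :
    vcomp α (vcomp β γ hk' hl') hj hi =
      vcomp ω γ (by rw [← hk, Category.assoc, hk', hj]) (by rw [← hl, Category.assoc, hl', hi]) := by
  subst h
  exact (vcomp_assoc' ..).symm

/-- The boundary arrows of an intermediate composite may be written in any way. -/
theorem vcomp_congr_boundary {x y x' y' x'' y'' x''' y''' : D}
    {f : x ⟶ x'} {f' : x' ⟶ x''} {f'' : x'' ⟶ x'''} {g : y ⟶ y'} {g' : y' ⟶ y''} {g'' : y'' ⟶ y'''}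
    {j : x ⟶ x'''} {i : y ⟶ y'''} {k k₁ : x' ⟶ x'''} {l l₁ : y' ⟶ y'''}
    {m : Pro x y} {n : Pro x' y'} {p : Pro x'' y''} {q : Pro x''' y'''}
    (α : Cell f g m n) (β : Cell f' g' n p) (γ : Cell f'' g'' p q)
    (hk : f' ≫ f'' = k) (hl : g' ≫ g'' = l) (hj : f ≫ k = j) (hi : g ≫ l = i)
    (hk₁ : f' ≫ f'' = k₁) (hl₁ : g' ≫ g'' = l₁) (hj₁ : f ≫ k₁ = j) (hi₁ : g ≫ l₁ = i) :
    vcomp α (vcomp β γ hk hl) hj hi = vcomp α (vcomp β γ hk₁ hl₁) hj₁ hi₁ := by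
  subst hk hl hk₁ hl₁
  rfl

theorem vid_vcomp' {x y x' y' : D} {f f' : x ⟶ x'} {g g' : y ⟶ y'} {m : Pro x y} {n : Pro x' y'}
    (α : Cell f g m n) (hf : 𝟙 x ≫ f = f') (hg : 𝟙 y ≫ g = g') :
    vcomp (vid m) α hf hg = castCell ((Category.id_comp f).symm.trans hf)
      ((Category.id_comp g).symm.trans hg) α := by
  subst hf hg
  conv_rhs => rw [← vid_vcomp α]
  rw [castCell_vcomp]

theorem hid_comp' {x y z : D} (f : x ⟶ y) (g : y ⟶ z) {k : x ⟶ z} (h h' : f ≫ g = k) :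
    vcomp (hid f) (hid g) h h' = hid k := by
  subst h
  exact (hid_comp f g).symm

theorem hcomp_vid_gcomp {x y z : D} {n n' n'' : Pro y z} (m : Pro x y) (β : GCell n n')
    (β' : GCell n' n'') :
    hcomp (vid m) (gcomp β β') = gcomp (hcomp (vid m) β) (hcomp (vid m) β') := by
  rw [← hcomp_gcomp, vid_gcomp]

theorem gcomp_hcomp_vid {x y z : D} {m m' m'' : Pro x y} (α : GCell m m') (α' : GCell m' m'')
    (n : Pro y z) :
    hcomp (gcomp α α') (vid n) = gcomp (hcomp α (vid n)) (hcomp α' (vid n)) := by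
  rw [← hcomp_gcomp, vid_gcomp]

/-- The category of proarrows and globular cells. -/
abbrev proCategory (x y : D) : Category (Pro x y) where
  Hom m n := GCell m n
  id := vid
  comp := gcomp
  id_comp := vid_gcomp
  comp_id := gcomp_vid
  assoc := gcomp_assoc

attribute [local instance] proCategory

/-- The bicategory of objects, proarrows and globular cells. -/
abbrev globularBicategory : Bicategory D where
  Hom x y := Pro x y
  id := pid
  comp := pcomp
  homCategory := proCategory
  whiskerLeft m _ _ α := hcomp (vid m) α
  whiskerRight α n := hcomp α (vid n)
  associator m n p := ⟨associator m n p, associatorInv m n p, associator_associatorInv m n p,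
    associatorInv_associator m n p⟩
  leftUnitor m := ⟨lunit m, lunitInv m, lunit_lunitInv m, lunitInv_lunit m⟩
  rightUnitor m := ⟨runit m, runitInv m, runit_runitInv m, runitInv_runit m⟩
  whiskerLeft_id m n := hcomp_vid m n
  whiskerLeft_comp m _ _ _ α β := hcomp_vid_gcomp m α β
  id_whiskerLeft {x y m n} α := by
    -- The naturality axiom of the unitor borders `α` with `hid (𝟙 x)`, which `hid_id` turns into
    -- the identity cell used by whiskering.
    have h : gcomp (hcomp (vid (pid x)) α) (lunit n) = gcomp (lunit m) α :=
      hid_id x ▸ lunit_naturality α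
    change hcomp _ _ = gcomp (lunit m) (gcomp α (lunitInv n))
    rw [← gcomp_assoc, ← h, gcomp_assoc]
    exact ((congrArg (gcomp _) (lunit_lunitInv n)).trans (gcomp_vid _)).symm
  comp_whiskerLeft {a b c d} m n p p' α := by
    have h : gcomp (hcomp (hcomp (vid m) (vid n)) α) (associator m n p') =
        gcomp (associator m n p) (hcomp (vid m) (hcomp (vid n) α)) := associator_naturality _ _ _
    change hcomp (vid (pcomp m n)) α =
      gcomp (associator m n p) (gcomp (hcomp (vid m) (hcomp (vid n) α)) (associatorInv m n p'))
    rw [← gcomp_assoc, ← h, gcomp_assoc, hcomp_vid]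
    exact ((congrArg (gcomp _) (associator_associatorInv m n p')).trans (gcomp_vid _)).symm
  id_whiskerRight m n := hcomp_vid m n
  comp_whiskerRight α β n := gcomp_hcomp_vid α β n
  whiskerRight_id {x y m n} α := by
    have h : gcomp (hcomp α (vid (pid y))) (runit n) = gcomp (runit m) α :=
      hid_id y ▸ runit_naturality α
    change hcomp _ _ = gcomp (runit m) (gcomp α (runitInv n))
    rw [← gcomp_assoc, ← h, gcomp_assoc]
    exact ((congrArg (gcomp _) (runit_runitInv n)).trans (gcomp_vid _)).symm
  whiskerRight_comp {a b c d m m'} α n p := by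
    have h : gcomp (hcomp (hcomp α (vid n)) (vid p)) (associator m' n p) =
        gcomp (associator m n p) (hcomp α (hcomp (vid n) (vid p))) := associator_naturality _ _ _
    change hcomp α (vid (pcomp n p)) =
      gcomp (associatorInv m n p) (gcomp (hcomp (hcomp α (vid n)) (vid p)) (associator m' n p))
    rw [h, ← gcomp_assoc, hcomp_vid]
    exact ((congrArg (gcomp · _) (associatorInv_associator m n p)).trans (vid_gcomp _)).symm
  whisker_assoc {a b c d} m n n' α p := by
    have h : gcomp (hcomp (hcomp (vid m) α) (vid p)) (associator m n' p) =
        gcomp (associator m n p) (hcomp (vid m) (hcomp α (vid p))) := associator_naturality _ _ _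
    change hcomp (hcomp (vid m) α) (vid p) =
      gcomp (associator m n p) (gcomp (hcomp (vid m) (hcomp α (vid p))) (associatorInv m n' p))
    rw [← gcomp_assoc, ← h, gcomp_assoc]
    exact ((congrArg (gcomp _) (associator_associatorInv m n' p)).trans (gcomp_vid _)).symm
  whisker_exchange {a b c m n p q} α β := by
    change gcomp (hcomp (vid m) β) (hcomp α (vid q)) = gcomp (hcomp α (vid p)) (hcomp (vid n) β)
    rw [← hcomp_gcomp, ← hcomp_gcomp, vid_gcomp, vid_gcomp, gcomp_vid, gcomp_vid]
  pentagon m n p q := (gcomp_assoc _ _ _).symm.trans (pentagon m n p q)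
  triangle m n := triangle m n

/-- Kelly's redundant coherence conditions, not part of the axioms but consequences of pentagon and
triangle. All of them concern globular cells only, so this and the next two facts are read off from
`globularBicategory`. -/
theorem lunit_pid (x : D) : lunit (pid x) = runit (pid x) :=
  @Bicategory.unitors_equal D globularBicategory x

theorem associator_lunit {x y z : D} (m : Pro x y) (n : Pro y z) :
    vcomp (associator (pid x) m n) (lunit (pcomp m n)) (Category.id_comp _) (Category.id_comp _) =
      hcomp (lunit m) (vid n) :=
  (@Bicategory.leftUnitor_whiskerRight D globularBicategory _ _ _ m n).symm

theorem associator_runit {x y z : D} (m : Pro x y) (n : Pro y z) :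
    vcomp (associator m n (pid z)) (hcomp (vid m) (runit n)) (Category.id_comp _)
        (Category.id_comp _) = runit (pcomp m n) :=
  (@Bicategory.rightUnitor_comp D globularBicategory _ _ _ m n).symm

/-- Pasting `ε` and `β`, where `ε` ends at an external identity, and removing the latter. -/
def lact {x y z y' z' : D} {f : x ⟶ y'} {g : y ⟶ y'} {h : z ⟶ z'} {p : Pro x y} {n : Pro y z}
    {n' : Pro y' z'} (ε : Cell f g p (pid y')) (β : Cell g h n n') : Cell f h (pcomp p n) n' :=
  vcomp (hcomp ε β) (lunit n') (Category.comp_id _) (Category.comp_id _)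

/-- Pasting `α` and `ε`, where `ε` ends at an external identity, and removing the latter. -/
def ract {x y z x' y' : D} {f : x ⟶ x'} {g : y ⟶ y'} {h : z ⟶ y'} {m : Pro x y} {p : Pro y z}
    {m' : Pro x' y'} (α : Cell f g m m') (ε : Cell g h p (pid y')) : Cell f h (pcomp m p) m' :=
  vcomp (hcomp α ε) (runit m') (Category.comp_id _) (Category.comp_id _)

end Calculus
-- Calculus of pasting with cells that end at an external identity.
section Actions

variable {D : Type u} [DoubleCategory.{w, t, v} D]

theorem vcomp_lact {x y z x' y' z' y'' z'' : D} {f : x ⟶ x'} {g : y ⟶ y'} {h : z ⟶ z'}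
    {f' : x' ⟶ y''} {g' : y' ⟶ y''} {h' : z' ⟶ z''} {i : x ⟶ y''} {j : y ⟶ y''} {k : z ⟶ z''}
    {m : Pro x y} {n : Pro y z} {m' : Pro x' y'} {n' : Pro y' z'} {n'' : Pro y'' z''}
    (σ : Cell f g m m') (δ : Cell g h n n') (ε : Cell f' g' m' (pid y'')) (β : Cell g' h' n' n'')
    (hi : f ≫ f' = i) (hj : g ≫ g' = j) (hk : h ≫ h' = k) :
    vcomp (hcomp σ δ) (lact ε β) hi hk = lact (vcomp σ ε hi hj) (vcomp δ β hj hk) := by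
  subst hi hj hk
  rw [lact, lact, hcomp_vcomp, vcomp_assoc']

theorem vcomp_ract {x y z x' y' z' x'' y'' : D} {f : x ⟶ x'} {g : y ⟶ y'} {h : z ⟶ z'}
    {f' : x' ⟶ x''} {g' : y' ⟶ y''} {h' : z' ⟶ y''} {i : x ⟶ x''} {j : y ⟶ y''} {k : z ⟶ y''}
    {m : Pro x y} {n : Pro y z} {m' : Pro x' y'} {n' : Pro y' z'} {m'' : Pro x'' y''}
    (δ : Cell f g m m') (σ : Cell g h n n') (α : Cell f' g' m' m'') (ε : Cell g' h' n' (pid y''))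
    (hi : f ≫ f' = i) (hj : g ≫ g' = j) (hk : h ≫ h' = k) :
    vcomp (hcomp δ σ) (ract α ε) hi hk = ract (vcomp δ α hi hj) (vcomp σ ε hj hk) := by
  subst hi hj hk
  rw [ract, ract, hcomp_vcomp, vcomp_assoc']

/-- By naturality of the unitor, a cell placed below the paste is pulled inside it; the part of the
external identity below `ε` then contributes `hid g'`. -/
theorem lact_vcomp {x y z y' z' y'' z'' : D} {f : x ⟶ y'} {g : y ⟶ y'} {h : z ⟶ z'}
    {g' : y' ⟶ y''} {h' : z' ⟶ z''} {i : x ⟶ y''} {j : y ⟶ y''} {k : z ⟶ z''}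
    {p : Pro x y} {n : Pro y z} {n' : Pro y' z'} {n'' : Pro y'' z''}
    (ε : Cell f g p (pid y')) (β : Cell g h n n') (γ : Cell g' h' n' n'')
    (hi : f ≫ g' = i) (hj : g ≫ g' = j) (hk : h ≫ h' = k) :
    vcomp (lact ε β) γ hi hk = lact (vcomp ε (hid g') hi hj) (vcomp β γ hj hk) := by
  subst hi hj hk
  rw [lact, lact, vcomp_assoc' _ _ _ _ _ _ _ (Category.id_comp _) (Category.id_comp _) rfl rfl,
    ← lunit_naturality, hcomp_vcomp, vcomp_assoc']

theorem ract_vcomp {x y z x' y' x'' y'' : D} {f : x ⟶ x'} {g : y ⟶ y'} {h : z ⟶ y'}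
    {f' : x' ⟶ x''} {g' : y' ⟶ y''} {i : x ⟶ x''} {j : y ⟶ y''} {k : z ⟶ y''}
    {m : Pro x y} {p : Pro y z} {m' : Pro x' y'} {m'' : Pro x'' y''}
    (α : Cell f g m m') (ε : Cell g h p (pid y')) (γ : Cell f' g' m' m'')
    (hi : f ≫ f' = i) (hj : g ≫ g' = j) (hk : h ≫ g' = k) :
    vcomp (ract α ε) γ hi hk = ract (vcomp α γ hi hj) (vcomp ε (hid g') hj hk) := by
  subst hi hj hk
  rw [ract, ract, vcomp_assoc' _ _ _ _ _ _ _ (Category.id_comp _) (Category.id_comp _) rfl rfl,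
    ← runit_naturality, hcomp_vcomp, vcomp_assoc']

theorem lact_hid {x z y' z' : D} {f : x ⟶ y'} {h : z ⟶ z'} {n : Pro x z} {n' : Pro y' z'}
    (β : Cell f h n n') :
    lact (hid f) β = vcomp (lunit n) β (Category.id_comp _) (Category.id_comp _) :=
  lunit_naturality β

theorem ract_hid {x y x' y' : D} {f : x ⟶ x'} {g : y ⟶ y'} {m : Pro x y} {m' : Pro x' y'}
    (α : Cell f g m m') :
    ract α (hid g) = vcomp (runit m) α (Category.id_comp _) (Category.id_comp _) :=
  runit_naturality α

/-- When both cells end at the same external identity, either one may be regarded as acting on the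
other, since the two unitors of `pid y'` agree. This is what lets a counit pass from the left side
of a paste to the right. -/
theorem lact_eq_ract {x y z y' : D} {f : x ⟶ y'} {g : y ⟶ y'} {h : z ⟶ y'} {p : Pro x y}
    {q : Pro y z} (ε : Cell f g p (pid y')) (ε' : Cell g h q (pid y')) :
    lact ε ε' = ract ε ε' := by
  rw [lact, ract, lunit_pid]

theorem lact_hid_right {x y y' : D} {f : x ⟶ y'} {g : y ⟶ y'} {p : Pro x y}
    (ε : Cell f g p (pid y')) :
    lact ε (hid g) = vcomp (runit p) ε (Category.id_comp _) (Category.id_comp _) := by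
  rw [lact_eq_ract, ract_hid]

theorem ract_hid_left {x y y' : D} {f : x ⟶ y'} {g : y ⟶ y'} {p : Pro x y}
    (ε : Cell f g p (pid y')) :
    ract (hid f) ε = vcomp (lunit p) ε (Category.id_comp _) (Category.id_comp _) := by
  rw [← lact_eq_ract, lact_hid]

/-- An associator is absorbed when one of three neighbouring cells ends at an external identity.
With that cell on the left the reason is `associator_lunit`; for the middle and right positions
below it is `triangle` and `associator_runit`. -/
theorem associator_lact {a b c d b' c' d' : D} {f : a ⟶ b'} {g : b ⟶ b'} {h : c ⟶ c'} {k : d ⟶ d'}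
    {m : Pro a b} {n : Pro b c} {p : Pro c d} {n' : Pro b' c'} {p' : Pro c' d'}
    (ε : Cell f g m (pid b')) (β : Cell g h n n') (γ : Cell h k p p') :
    vcomp (associator m n p) (lact ε (hcomp β γ)) (Category.id_comp _) (Category.id_comp _) =
      hcomp (lact ε β) γ := by
  rw [lact, lact, ← vcomp_assoc' _ _ _ (Category.id_comp _) (Category.id_comp _)
    (Category.comp_id _) (Category.comp_id _), ← associator_naturality,
    vcomp_assoc' _ _ _ _ _ _ _ (Category.id_comp _) (Category.id_comp _) (Category.comp_id _)
    (Category.comp_id _), associator_lunit]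
  conv_rhs => rw [← vcomp_vid γ, hcomp_vcomp']

theorem associator_hcomp_lact {a b c d a' b' d' : D} {f : a ⟶ a'} {g : b ⟶ b'} {h : c ⟶ b'}
    {k : d ⟶ d'} {m : Pro a b} {n : Pro b c} {p : Pro c d} {m' : Pro a' b'} {p' : Pro b' d'}
    (α : Cell f g m m') (ε : Cell g h n (pid b')) (γ : Cell h k p p') :
    vcomp (associator m n p) (hcomp α (lact ε γ)) (Category.id_comp _) (Category.id_comp _) =
      hcomp (ract α ε) γ := by
  have h₁ : hcomp α (lact ε γ) = vcomp (hcomp α (hcomp ε γ)) (hcomp (vid m') (lunit p'))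
      (Category.comp_id _) (Category.comp_id _) := by
    rw [← hcomp_vcomp' _ _ _ _ _ (Category.comp_id _), vcomp_vid, lact]
  rw [h₁, ← vcomp_assoc' _ _ _ (Category.id_comp _) (Category.id_comp _)
    (Category.comp_id _) (Category.comp_id _), ← associator_naturality,
    vcomp_assoc' _ _ _ _ _ _ _ (Category.id_comp _) (Category.id_comp _) (Category.comp_id _)
    (Category.comp_id _), triangle]
  conv_rhs => rw [← vcomp_vid γ, ract, hcomp_vcomp']

theorem associator_ract {a b c d a' b' c' : D} {f : a ⟶ a'} {g : b ⟶ b'} {h : c ⟶ c'}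
    {k : d ⟶ c'} {m : Pro a b} {n : Pro b c} {p : Pro c d} {m' : Pro a' b'} {n' : Pro b' c'}
    (α : Cell f g m m') (β : Cell g h n n') (ε : Cell h k p (pid c')) :
    vcomp (associator m n p) (hcomp α (ract β ε)) (Category.id_comp _) (Category.id_comp _) =
      ract (hcomp α β) ε := by
  have h₁ : hcomp α (ract β ε) = vcomp (hcomp α (hcomp β ε)) (hcomp (vid m') (runit n'))
      (Category.comp_id _) (Category.comp_id _) := by
    rw [← hcomp_vcomp' _ _ _ _ _ (Category.comp_id _), vcomp_vid, ract]
  rw [h₁, ← vcomp_assoc' _ _ _ (Category.id_comp _) (Category.id_comp _)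
    (Category.comp_id _) (Category.comp_id _), ← associator_naturality,
    vcomp_assoc' _ _ _ _ _ _ _ (Category.id_comp _) (Category.id_comp _) (Category.comp_id _)
    (Category.comp_id _), associator_runit, ract]

theorem associatorInv_vcomp_eq {a b c d a' d' : D} {f : a ⟶ a'} {g : d ⟶ d'}
    {m : Pro a b} {n : Pro b c} {p : Pro c d} {q : Pro a' d'}
    {α : Cell f g (pcomp m (pcomp n p)) q} {β : Cell f g (pcomp (pcomp m n) p) q}
    (h : vcomp (associator m n p) α (Category.id_comp _) (Category.id_comp _) = β) :
    vcomp (associatorInv m n p) β (Category.id_comp _) (Category.id_comp _) = α := by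
  rw [← h, ← vcomp_assoc' _ _ _ (Category.id_comp _) (Category.id_comp _) (Category.id_comp _)
    (Category.id_comp _), associatorInv_associator, vid_vcomp]

theorem lunitInv_naturality {x y x' y' : D} {f : x ⟶ x'} {g : y ⟶ y'} {m : Pro x y}
    {n : Pro x' y'} (α : Cell f g m n) :
    vcomp (lunitInv m) (hcomp (hid f) α) (Category.id_comp f) (Category.id_comp g) =
      vcomp α (lunitInv n) (Category.comp_id f) (Category.comp_id g) := by
  rw [← vcomp_vid (hcomp (hid f) α), ← lunit_lunitInv n,
    ← vcomp_assoc' (hcomp _ _) _ _ (Category.comp_id _) (Category.comp_id _) (Category.comp_id _)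
    (Category.comp_id _), lunit_naturality,
    ← vcomp_assoc' _ _ _ (Category.id_comp _) (Category.id_comp _) (Category.comp_id _)
    (Category.comp_id _), ← vcomp_assoc' (lunitInv m) _ _ (Category.id_comp _) (Category.id_comp _)
    (Category.id_comp _) (Category.id_comp _), lunitInv_lunit, vid_vcomp]

end Actions
-- The universal property of companions, and their composition.
section CompanionCalculus

variable {D : Type u} [DoubleCategory.{w, t, v} D]

theorem lact_counit_pid {x y : D} {f : x ⟶ y} {p : Pro x y} (ε : Cell f (𝟙 y) p (pid y)) :
    lact ε (vid (pid y)) = vcomp (runit p) ε (Category.id_comp _) (Category.id_comp _) := by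
  rw [← hid_id, lact_hid_right]

theorem lunitInv_lact_hid {x z y' z' : D} {f : x ⟶ y'} {h : z ⟶ z'} {n : Pro x z} {n' : Pro y' z'}
    (β : Cell f h n n') :
    vcomp (lunitInv n) (lact (hid f) β) (Category.id_comp _) (Category.id_comp _) = β := by
  rw [lact_hid, ← vcomp_assoc' _ _ _ (Category.id_comp _) (Category.id_comp _)
    (Category.id_comp _) (Category.id_comp _), lunitInv_lunit, vid_vcomp]

theorem runitInv_ract_hid {x z y' z' : D} {f : x ⟶ y'} {h : z ⟶ z'} {n : Pro x z} {n' : Pro y' z'}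
    (β : Cell f h n n') :
    vcomp (runitInv n) (ract β (hid h)) (Category.id_comp _) (Category.id_comp _) = β := by
  rw [ract_hid, ← vcomp_assoc' _ _ _ (Category.id_comp _) (Category.id_comp _)
    (Category.id_comp _) (Category.id_comp _), runitInv_runit, vid_vcomp]

theorem lunitInv_associatorInv {x y z : D} (m : Pro x y) (n : Pro y z) :
    vcomp (lunitInv (pcomp m n)) (associatorInv (pid x) m n) (Category.id_comp _)
      (Category.id_comp _) = hcomp (lunitInv m) (vid n) := by
  have h₁ : gcomp (hcomp (lunitInv m) (vid n)) (hcomp (lunit m) (vid n)) = vid _ := by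
    rw [← hcomp_gcomp, vid_gcomp]
    exact (congrArg (hcomp · _) (lunitInv_lunit m)).trans (hcomp_vid m n)
  rw [← associator_lunit] at h₁
  have h₂ := congrArg (fun α => gcomp (gcomp α (lunitInv (pcomp m n))) (associatorInv _ _ _)) h₁
  rw [vid_gcomp] at h₂
  refine h₂.symm.trans ?_
  change gcomp (gcomp (gcomp _ (gcomp _ _)) _) _ = _
  simp only [gcomp_assoc]
  have h₃ : gcomp (lunit (pcomp m n)) (gcomp (lunitInv (pcomp m n)) (associatorInv _ m n)) =
      associatorInv _ m n := by
    rw [← gcomp_assoc]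
    exact (congrArg (gcomp · _) (lunit_lunitInv _)).trans (vid_gcomp _)
  rw [h₃]
  exact (congrArg (gcomp _) (associator_associatorInv _ m n)).trans (gcomp_vid _)

namespace Companion

variable {x y : D} {f : x ⟶ y} (c : Companion f)

theorem lunitInv_ract_unit_counit :
    vcomp (lunitInv c.pro) (ract c.unit c.counit) (Category.id_comp _) (Category.id_comp _) =
      vid c.pro :=
  (vcomp_assoc' ..).symm.trans c.unit_hcomp_counit

/-- The horizontal companion identity whiskered with `n`; the associators relating the two
bracketings cancel. -/
theorem lunitInv_unit_lact_counit {z : D} (n : Pro y z) :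
    vcomp (lunitInv (pcomp c.pro n)) (hcomp c.unit (lact c.counit (vid n))) (Category.id_comp _)
      (Category.id_comp _) = vid (pcomp c.pro n) := by
  rw [← associatorInv_vcomp_eq (associator_hcomp_lact c.unit c.counit (vid n)),
    ← vcomp_assoc' _ _ _ (Category.id_comp _) (Category.id_comp _) (Category.id_comp _)
    (Category.id_comp _), lunitInv_associatorInv,
    ← hcomp_vcomp' _ _ _ _ _ (Category.id_comp _), vid_vcomp, lunitInv_ract_unit_counit,
    hcomp_vid]

/-- The factorization of a cell through the counit of a companion. -/
def lift {z z' w' : D} {a : z ⟶ x} {k : z ⟶ y} {b : z' ⟶ w'} {q : Pro z z'} {n : Pro y w'}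
    (θ : Cell k b q n) (h : a ≫ f = k) : Cell a b q (pcomp c.pro n) :=
  vcomp (lunitInv q) (hcomp (vcomp (hid a) c.unit (Category.comp_id a) h) θ) (Category.id_comp _)
    (Category.id_comp _)

/-- Existence half of the universal property. Only the vertical identity `η · ε = id_f` is used; the
next lemma, the uniqueness half, uses the horizontal one. -/
theorem lift_lact {z z' w' : D} {a : z ⟶ x} {k : z ⟶ y} {b : z' ⟶ w'} {q : Pro z z'}
    {n : Pro y w'} (θ : Cell k b q n) (h : a ≫ f = k) :
    vcomp (c.lift θ h) (lact c.counit (vid n)) h (Category.comp_id _) = θ := by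
  rw [lift, vcomp_assoc' _ _ _ _ _ _ _ h (Category.comp_id _) (Category.id_comp _)
    (Category.id_comp _), vcomp_lact _ _ _ _ _ (Category.comp_id _), vcomp_vid,
    vcomp_assoc' _ _ _ _ _ _ _ (Category.id_comp _) (Category.comp_id _) h h,
    c.unit_vcomp_counit, hid_comp', lunitInv_lact_hid]

theorem lift_vcomp_lact {z z' w' : D} {a : z ⟶ x} {k : z ⟶ y} {b : z' ⟶ w'} {q : Pro z z'}
    {n : Pro y w'} (θ : Cell a b q (pcomp c.pro n)) (h : a ≫ f = k) :
    c.lift (vcomp θ (lact c.counit (vid n)) h (Category.comp_id _)) h = θ := by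
  rw [lift, hcomp_vcomp' _ _ _ _ _ _ _, ← vcomp_assoc' _ _ _ (Category.id_comp _)
    (Category.id_comp _) (Category.comp_id _) (Category.comp_id _), lunitInv_naturality,
    vcomp_assoc' _ _ _ _ _ _ _ (Category.id_comp _) (Category.id_comp _) (Category.comp_id _)
    (Category.comp_id _), lunitInv_unit_lact_counit, vcomp_vid]

/-- The testing principle: equality of cells into `f_! ⊙ n` may be checked after the counit. The
boundary arrows `k` and `l` are kept free so that it applies whatever form the composite arrows
take. -/
theorem lact_ext {z z' w' : D} {a : z ⟶ x} {k : z ⟶ y} {b l : z' ⟶ w'} {q : Pro z z'}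
    {n : Pro y w'} {θ θ' : Cell a b q (pcomp c.pro n)} (h : a ≫ f = k) (hl : b ≫ 𝟙 _ = l)
    (e : vcomp θ (lact c.counit (vid n)) h hl = vcomp θ' (lact c.counit (vid n)) h hl) :
    θ = θ' := by
  obtain rfl : b = l := (Category.comp_id b).symm.trans hl
  rw [← c.lift_vcomp_lact θ h, e, lift_vcomp_lact]

theorem counit_ext {z z' : D} {a : z ⟶ x} {k : z ⟶ y} {b l : z' ⟶ y} {q : Pro z z'}
    {σ σ' : Cell a b q c.pro} (h : a ≫ f = k) (hl : b ≫ 𝟙 _ = l)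
    (e : vcomp σ c.counit h hl = vcomp σ' c.counit h hl) : σ = σ' := by
  -- Reduction to `lact_ext` with `n = pid y`: the inverse right unitor turns a cell into `f_!` into
  -- one into `f_! ⊙ id`.
  have key : ∀ σ : Cell a b q c.pro,
      vcomp (vcomp σ (runitInv c.pro) (Category.comp_id _) (Category.comp_id _))
        (lact c.counit (vid (pid y))) h hl = vcomp σ c.counit h hl := by
    intro σ
    rw [lact_counit_pid, vcomp_assoc' _ _ _ _ _ _ _ (Category.id_comp _) (Category.id_comp _) h hl,
      ← vcomp_assoc' (runitInv _) _ _ (Category.id_comp _) (Category.id_comp _)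
      (Category.id_comp _) (Category.id_comp _), runitInv_runit, vid_vcomp]
  have h₁ := c.lact_ext h hl ((key σ).trans (e.trans (key σ').symm))
  have h₂ : ∀ σ : Cell a b q c.pro,
      vcomp (vcomp σ (runitInv c.pro) (Category.comp_id _) (Category.comp_id _)) (runit c.pro)
        (Category.comp_id _) (Category.comp_id _) = σ := by
    intro σ
    rw [vcomp_assoc' _ _ _ _ _ _ _ (Category.id_comp _) (Category.id_comp _) (Category.comp_id _)
      (Category.comp_id _), runitInv_runit, vcomp_vid]
  rw [← h₂ σ, h₁, h₂]

/-- The factorization through the counit of a cell ending at an external identity. -/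
def liftPid {z z' : D} {a : z ⟶ x} {k : z ⟶ y} {b : z' ⟶ y} {q : Pro z z'}
    (κ : Cell k b q (pid y)) (h : a ≫ f = k) : Cell a b q c.pro :=
  vcomp (c.lift κ h) (runit c.pro) (Category.comp_id _) (Category.comp_id _)

theorem liftPid_counit {z z' : D} {a : z ⟶ x} {k : z ⟶ y} {b : z' ⟶ y} {q : Pro z z'}
    (κ : Cell k b q (pid y)) (h : a ≫ f = k) :
    vcomp (c.liftPid κ h) c.counit h (Category.comp_id _) = κ := by
  rw [liftPid, vcomp_assoc' _ _ _ _ _ _ _ (Category.id_comp _) (Category.id_comp _) h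
    (Category.comp_id _), ← lact_counit_pid,
    lift_lact]

/-- A cell `ε` that is monic for globular cells and admits `η` with `η ; ε = id_f` is the counit of
a companion. -/
def ofMono {p : Pro x y} (η : Cell (𝟙 x) f (pid x) p) (ε : Cell f (𝟙 y) p (pid y))
    (h : vcomp η ε (Category.id_comp f) (Category.comp_id f) = hid f)
    (mono : ∀ σ σ' : GCell p p, vcomp σ ε (Category.id_comp _) (Category.id_comp _) =
      vcomp σ' ε (Category.id_comp _) (Category.id_comp _) → σ = σ') : Companion f where
  pro := p
  unit := η
  counit := ε
  unit_hcomp_counit := by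
    -- After pasting with `ε` the vertical identity `h` collapses the left side to `ε`, so monicity
    -- yields the horizontal identity.
    apply mono
    rw [gcomp_assoc]
    dsimp only [gcomp]
    rw [vid_vcomp]
    change vcomp (vcomp _ (ract η ε) _ _) _ _ _ = _
    rw [vcomp_assoc' _ _ _ _ _ _ _ (Category.id_comp _) (Category.id_comp _) (Category.id_comp _)
      (Category.id_comp _), ract_vcomp _ _ _ _ (Category.comp_id _) (Category.id_comp _), h,
      hid_id, vcomp_vid, ← lact_eq_ract, lunitInv_lact_hid]
  unit_vcomp_counit := h

/-- The companion of a composite arrow. -/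
def comp {z : D} {g : y ⟶ z} (c' : Companion g) {k : x ⟶ z} (hk : f ≫ g = k) : Companion k :=
  ofMono (p := pcomp c.pro c'.pro)
    (vcomp (vcomp c.unit (runitInv c.pro) (Category.comp_id _) (Category.comp_id _))
      (hcomp (vid c.pro) c'.unit) (Category.comp_id _) hk)
    (vcomp (lact c.counit (vid c'.pro)) c'.counit hk (Category.id_comp _))
    (by
      -- The unit of `c'` is moved below the counit of `c`, so that each unit meets its own counit.
      have h₁ : vcomp (hcomp (vid c.pro) c'.unit) (lact c.counit (vid c'.pro)) (Category.id_comp _)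
          (Category.comp_id _) = vcomp (vcomp (runit c.pro) c.counit (Category.id_comp _)
            (Category.id_comp _)) c'.unit (Category.comp_id _) (Category.id_comp _) := by
        rw [← lact_hid_right, lact_vcomp _ _ _ _ (Category.comp_id _),
          vcomp_lact _ _ _ _ _ (Category.comp_id _), hid_id, vid_vcomp, vcomp_vid, vcomp_vid,
          vid_vcomp]
      rw [vcomp_assoc' _ _ _ _ _ _ _ (Category.id_comp k) (Category.comp_id g) (Category.id_comp k)
        hk, vcomp_reassoc h₁, vcomp_assoc' (vcomp (runit _) _ _ _) _ _ _ _ _ _ (Category.id_comp g)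
        (Category.comp_id g) hk (Category.id_comp g), c'.unit_vcomp_counit,
        vcomp_assoc' (runit _) _ _ _ _ _ _ hk (Category.id_comp g) (Category.id_comp k)
        (Category.id_comp g), vcomp_assoc' _ (runitInv _) _ _ _ _ _ (Category.id_comp k)
        (Category.id_comp g) (Category.id_comp k) hk, ← vcomp_assoc' (runitInv _) _ _
        (Category.id_comp _) (Category.id_comp _) (Category.id_comp k) (Category.id_comp g),
        runitInv_runit, vid_vcomp, ← vcomp_assoc' _ _ _ (Category.id_comp f) (Category.comp_id f)
        hk hk, c.unit_vcomp_counit, hid_comp'])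
    (fun σ σ' h => by
      -- The composite counit is monic because it factors into two pastes that are cancelled one
      -- after the other.
      refine c.lact_ext (Category.id_comp _) (Category.comp_id _) (c'.counit_ext hk
        (Category.comp_id _) ?_)
      rwa [vcomp_assoc' _ _ _ _ _ _ _ hk (Category.id_comp _) (Category.id_comp _)
        (Category.comp_id _), vcomp_assoc' _ _ _ _ _ _ _ hk (Category.id_comp _)
        (Category.id_comp _) (Category.comp_id _)])

/-- A globular cell between companions of one arrow that is compatible with the counits is
invertible. -/
theorem isInvertible_of_counit (c' : Companion f) (θ : GCell c.pro c'.pro)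
    (h : vcomp θ c'.counit (Category.id_comp _) (Category.comp_id _) = c.counit) :
    IsInvertible θ := by
  have h' := c.liftPid_counit c'.counit (Category.id_comp f)
  refine ⟨c.liftPid c'.counit (Category.id_comp f),
    c.counit_ext (Category.id_comp f) (Category.comp_id _) ?_,
    c'.counit_ext (Category.id_comp f) (Category.comp_id _) ?_⟩
  · rw [vid_vcomp, vcomp_assoc' _ _ _ _ _ _ _ (Category.id_comp f) (Category.comp_id _)
      (Category.id_comp f) (Category.comp_id _), h', h]
  · rw [vid_vcomp, vcomp_assoc' _ _ _ _ _ _ _ (Category.id_comp f) (Category.comp_id _)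
      (Category.id_comp f) (Category.comp_id _), h, h']

theorem unit_gcomp_counit (c : Companion (𝟙 x)) : gcomp c.unit c.counit = vid (pid x) :=
  c.unit_vcomp_counit.trans (hid_id x)

/-- With `unit_gcomp_counit` this makes a companion of an identity arrow isomorphic to `pid x`,
which is the source of the invertibility of `s` and `t`. -/
theorem counit_gcomp_unit (c : Companion (𝟙 x)) : gcomp c.counit c.unit = vid c.pro := by
  refine c.counit_ext (Category.id_comp _) (Category.comp_id _) ?_
  change gcomp (gcomp c.counit c.unit) c.counit = gcomp (vid _) c.counit
  rw [gcomp_assoc, unit_gcomp_counit, gcomp_vid, vid_gcomp]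

end Companion

end CompanionCalculus
end DoubleCategory

/-! ### Double functors preserve companions. -/

namespace DoubleFunctor

variable {D : Type u₁} [DoubleCategory.{w₁, t₁, v₁} D]
  {E : Type u₂} [DoubleCategory.{w₂, t₂, v₂} E] (F : DoubleFunctor D E)

/-- The image of a cell ending at an external identity, made to end at an external identity. -/
def mapCounit {x y y' : D} {f : x ⟶ y'} {g : y ⟶ y'} {p : Pro x y} (ε : Cell f g p (pid y'))
    {g' : F.obj y ⟶ F.obj y'} (hg : F.map g = g') :
    Cell (F.map f) g' (F.mapPro p) (pid (F.obj y')) :=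
  vcomp (F.mapCell ε) (F.mapIdInv y') (Category.comp_id _) ((Category.comp_id _).trans hg)

theorem mapIdInv_lunit {x y : D} (m : Pro x y) :
    vcomp (hcomp (F.mapIdInv x) (vid (F.mapPro m))) (lunit (F.mapPro m)) (Category.id_comp _)
        (Category.id_comp _) = gcomp (F.mapComp (pid x) m) (F.mapGlob (lunit m)) := by
  change gcomp _ _ = _
  rw [← F.map_lunit, gcomp_assoc, ← gcomp_assoc (hcomp _ _), ← hcomp_gcomp, F.mapIdInv_mapId,
    vid_gcomp, hcomp_vid, vid_gcomp]

theorem mapIdInv_runit {x y : D} (m : Pro x y) :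
    vcomp (hcomp (vid (F.mapPro m)) (F.mapIdInv y)) (runit (F.mapPro m)) (Category.id_comp _)
        (Category.id_comp _) = gcomp (F.mapComp m (pid y)) (F.mapGlob (runit m)) := by
  change gcomp _ _ = _
  rw [← F.map_runit, gcomp_assoc, ← gcomp_assoc (hcomp _ _), ← hcomp_gcomp, F.mapIdInv_mapId,
    vid_gcomp, hcomp_vid, vid_gcomp]

/-- Unit coherence of `F` lets the action pass through `F` up to `mapComp`. The arrows `g'` and `h'`
allow `F.map (𝟙 _)` to be replaced by `𝟙 _`, as the counit of a companion requires. -/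
theorem lact_mapCounit {x y z y' z' : D} {f : x ⟶ y'} {g : y ⟶ y'} {h : z ⟶ z'} {p : Pro x y}
    {n : Pro y z} {n' : Pro y' z'} (ε : Cell f g p (pid y')) (β : Cell g h n n')
    {g' : F.obj y ⟶ F.obj y'} {h' : F.obj z ⟶ F.obj z'} (hg : F.map g = g') (hh : F.map h = h') :
    lact (F.mapCounit ε hg) (castCell hg hh (F.mapCell β)) =
      vcomp (F.mapComp p n) (F.mapCell (lact ε β)) (Category.id_comp _)
        ((Category.id_comp _).trans hh) := by
  subst hg hh
  change lact (F.mapCounit ε rfl) (F.mapCell β) = _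
  rw [← vcomp_vid (F.mapCell β), lact, mapCounit,
    hcomp_vcomp' _ _ _ _ _ (Category.comp_id _), vcomp_assoc' _ _ _ _ _ _ _ (Category.id_comp _)
    (Category.id_comp _) (Category.comp_id _) (Category.comp_id _), mapIdInv_lunit,
    ← vcomp_assoc' _ _ _ (Category.comp_id _) (Category.comp_id _) (Category.comp_id _)
    (Category.comp_id _), F.mapComp_naturality, lact, F.mapCell_vcomp',
    DoubleFunctorBase.mapGlob, vcomp_castCell]
  apply vcomp_assoc'

theorem ract_mapCounit {x y z x' y' : D} {f : x ⟶ x'} {g : y ⟶ y'} {h : z ⟶ y'} {m : Pro x y}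
    {p : Pro y z} {m' : Pro x' y'} (α : Cell f g m m') (ε : Cell g h p (pid y'))
    {h' : F.obj z ⟶ F.obj y'} (hh : F.map h = h') :
    ract (F.mapCell α) (F.mapCounit ε hh) =
      vcomp (F.mapComp m p) (F.mapCell (ract α ε)) (Category.id_comp _)
        ((Category.id_comp _).trans hh) := by
  subst hh
  rw [← vcomp_vid (F.mapCell α), ract, mapCounit,
    hcomp_vcomp' _ _ _ _ (Category.comp_id _) (Category.comp_id _),
    vcomp_assoc' _ _ _ _ _ _ _ (Category.id_comp _)
    (Category.id_comp _) (Category.comp_id _) (Category.comp_id _), mapIdInv_runit,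
    ← vcomp_assoc' _ _ _ (Category.comp_id _) (Category.comp_id _) (Category.comp_id _)
    (Category.comp_id _), F.mapComp_naturality, ract, F.mapCell_vcomp',
    DoubleFunctorBase.mapGlob, vcomp_castCell]
  apply vcomp_assoc'

theorem lact_mapCounit_vid {x y z : D} {f : x ⟶ y} {p : Pro x y} (n : Pro y z)
    (ε : Cell f (𝟙 y) p (pid y)) :
    lact (F.mapCounit ε (F.map_id y)) (vid (F.mapPro n)) =
      vcomp (F.mapComp p n) (F.mapCell (lact ε (vid n))) (Category.id_comp _)
        ((Category.id_comp _).trans (F.map_id z)) := by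
  rw [← lact_mapCounit F ε (vid n) (F.map_id y) (F.map_id z), F.mapCell_vid]

theorem vcomp_mapCounit {x y x' y' y'' : D} {f : x ⟶ x'} {g : y ⟶ y'} {f' : x' ⟶ y''}
    {g' : y' ⟶ y''} {k : x ⟶ y''} {l : y ⟶ y''} {p : Pro x y} {q : Pro x' y'} (α : Cell f g p q)
    (ε : Cell f' g' q (pid y'')) (hk : f ≫ f' = k) (hl : g ≫ g' = l)
    {i : F.obj y' ⟶ F.obj y''} {j : F.obj y ⟶ F.obj y''} (hi : F.map g' = i) (hj : F.map l = j) :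
    F.mapCounit (vcomp α ε hk hl) hj = vcomp (F.mapCell α) (F.mapCounit ε hi)
      (by rw [← F.map_comp, hk]) (by rw [← hi, ← hj, ← F.map_comp, hl]) := by
  subst hi hj hk hl
  rw [mapCounit, mapCounit, F.mapCell_vcomp']
  apply vcomp_assoc'

theorem mapCounit_hid {x y : D} (f : x ⟶ y) {f' : F.obj x ⟶ F.obj y} (h : F.map f = f') :
    F.mapCounit (hid f) h = vcomp (F.mapIdInv x) (hid f')
      ((Category.id_comp _).trans h.symm) (Category.id_comp _) := by
  subst h
  have h := F.mapId_naturality f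
  rw [mapCounit, ← vcomp_vid (hid (F.map f)), ← F.mapId_mapIdInv y,
    ← vcomp_assoc' (hid _) _ _ (Category.comp_id _) (Category.comp_id _) (Category.comp_id _)
    (Category.comp_id _), h, vcomp_assoc' (F.mapId x) _ _ _ _ _ _ (Category.comp_id _)
    (Category.comp_id _) (Category.id_comp _) (Category.id_comp _), ← vcomp_assoc' (F.mapIdInv x) _ _
    (Category.id_comp _) (Category.id_comp _) (Category.id_comp _) (Category.id_comp _),
    show vcomp (F.mapIdInv x) (F.mapId x) (Category.id_comp _) (Category.id_comp _) = vid _ from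
      F.mapIdInv_mapId x, vid_vcomp]

/-- The image of a companion. -/
def mapCompanion {x y : D} {f : x ⟶ y} (c : Companion f) : Companion (F.map f) where
  pro := F.mapPro c.pro
  unit := vcomp (F.mapId x) (F.mapCell c.unit) ((Category.id_comp _).trans (F.map_id x))
    (Category.id_comp _)
  counit := F.mapCounit c.counit (F.map_id y)
  unit_hcomp_counit := by
    -- The horizontal identity is restated without inverse unitors; in this form `ract_mapCounit`
    -- and `map_lunit` carry it through `F`.
    have h₁ : ract c.unit c.counit = lunit c.pro := by
      rw [← vid_vcomp (ract _ _), ← lunit_lunitInv, vcomp_assoc' _ _ _ _ _ _ _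
        (Category.id_comp _) (Category.id_comp _) (Category.id_comp _) (Category.id_comp _),
        c.lunitInv_ract_unit_counit, vcomp_vid]
    have h₂ : ract (vcomp (F.mapId x) (F.mapCell c.unit) ((Category.id_comp _).trans (F.map_id x))
        (Category.id_comp _)) (F.mapCounit c.counit (F.map_id y)) = lunit (F.mapPro c.pro) := by
      rw [← F.map_lunit, ← vid_vcomp (F.mapCounit _ _), ← vcomp_ract, ract_mapCounit, h₁,
        gcomp_assoc, gcomp, gcomp, DoubleFunctorBase.mapGlob, vcomp_castCell]
      apply vcomp_congr_boundary
    refine (vcomp_assoc' ..).trans ((congrArg (gcomp _) h₂).trans (lunitInv_lunit _))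
  unit_vcomp_counit := by
    rw [vcomp_assoc' _ _ _ _ _ _ _ ((F.map_comp _ _).symm.trans (congrArg F.map (Category.id_comp f)))
      (Category.comp_id _) (Category.id_comp _) (Category.id_comp _),
      ← F.vcomp_mapCounit c.unit c.counit (Category.id_comp f) (Category.comp_id f) (F.map_id y) rfl,
      c.unit_vcomp_counit, mapCounit_hid, ← vcomp_assoc' _ _ _ (Category.id_comp _)
      (Category.id_comp _) (Category.id_comp _) (Category.id_comp _),
      show vcomp (F.mapId x) (F.mapIdInv x) (Category.id_comp _) (Category.id_comp _) = vid _ from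
        F.mapId_mapIdInv x, vid_vcomp]

end DoubleFunctor

/-! ### Counit equations for slid cells. -/

namespace DoubleCategory

section Sliding

variable {D : Type u} [DoubleCategory.{w, t, v} D]

theorem gcomp_vcomp {x y x' y' : D} {m n p : Pro x y} {q : Pro x' y'} {f : x ⟶ x'} {g : y ⟶ y'}
    (α : GCell m n) (β : GCell n p) (γ : Cell f g p q) :
    vcomp (gcomp α β) γ (Category.id_comp _) (Category.id_comp _) =
      vcomp α (vcomp β γ (Category.id_comp _) (Category.id_comp _)) (Category.id_comp _)
        (Category.id_comp _) :=
  vcomp_assoc' ..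

theorem vcomp_hid_of_eq {x y y' : D} {f : x ⟶ y'} {g : y ⟶ y'} {m : Pro x y}
    (α : Cell f g m (pid y')) {a : y' ⟶ y'} (ha : a = 𝟙 y') (hf : f ≫ a = f) (hg : g ≫ a = g) :
    vcomp α (hid a) hf hg = α := by
  subst ha
  rw [hid_id, vcomp_vid]

/-- By interchange, a cell standing beside `p` slides below a counit on `p`. This is the move that
carries a test counit past whiskered factors. -/
theorem hcomp_vid_lact {x y z z' : D} {f : x ⟶ y} {h : z ⟶ z'} {p : Pro x y} {n : Pro y z}
    {n' : Pro y z'} (ε : Cell f (𝟙 y) p (pid y)) (β : Cell (𝟙 y) h n n') :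
    vcomp (hcomp (vid p) β) (lact ε (vid n')) (Category.id_comp _) (Category.comp_id _) =
      vcomp (lact ε (vid n)) β (Category.comp_id _) (Category.id_comp _) := by
  rw [vcomp_lact _ _ _ _ _ (Category.id_comp _), vid_vcomp, vcomp_vid,
    lact_vcomp _ _ _ _ (Category.id_comp _), hid_id, vcomp_vid, vid_vcomp]

/-- The slide is the lift of `ract α cg.counit`, so this equation characterizes it; later arguments
about sliding appeal to it rather than to the definition. -/
theorem slide_lact {x y x' y' : D} {f : x ⟶ x'} {g : y ⟶ y'} {m : Pro x y} {n : Pro x' y'}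
    (cf : Companion f) (cg : Companion g) (α : Cell f g m n) :
    vcomp (slide cf cg α) (lact cf.counit (vid n)) (Category.id_comp _) (Category.id_comp _) =
      ract α cg.counit := by
  have h : slide cf cg α = cf.lift (ract α cg.counit) (Category.id_comp f) := by
    rw [slide, gcomp_assoc, Companion.lift, hid_id, vid_vcomp, ract, gcomp]
    congr 1
    rw [gcomp, ← hcomp_vcomp' _ _ _ _ (Category.comp_id _) (Category.comp_id _), vcomp_vid]
  rw [h, cf.lift_lact]

/-- Compatibility of a globular cell with counits, with and without unitors. -/
theorem vcomp_hcomp_counit {x y x' y' : D} {f : x ⟶ x'} {g : y ⟶ y'} {m : Pro x y} {n : Pro x' y'}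
    {p : Pro x x'} {q : Pro y y'} {τ : GCell (pcomp m q) (pcomp p n)} {α : Cell f g m n}
    {ε : Cell f (𝟙 x') p (pid x')} {ε' : Cell g (𝟙 y') q (pid y')}
    (h : vcomp τ (lact ε (vid n)) (Category.id_comp _) (Category.id_comp _) = ract α ε') :
    vcomp τ (hcomp ε (vid n)) (Category.id_comp _) (Category.id_comp _) =
      vcomp (hcomp α ε') (gcomp (runit n) (lunitInv n)) (Category.comp_id _)
        (Category.comp_id _) := by
  have h₁ := congrArg (fun γ => vcomp γ (lunitInv n) (Category.comp_id _) (Category.comp_id _)) h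
  rw [lact, vcomp_assoc' _ _ _ _ _ _ _ (Category.comp_id _) (Category.comp_id _)
    (Category.id_comp _) (Category.id_comp _), vcomp_assoc' (hcomp ε _) _ _ _ _ _ _
    (Category.comp_id _) (Category.comp_id _) (Category.comp_id _) (Category.comp_id _),
    lunit_lunitInv, vcomp_vid, ract] at h₁
  exact h₁.trans (vcomp_assoc' ..)

end Sliding

end DoubleCategory

/-! ### The oplax protransformation formed by the companions of a natural transformation. -/

namespace DoubleNatTrans

variable {D : Type u₁} [DoubleCategory.{w₁, t₁, v₁} D]
  {E : Type u₂} [DoubleCategory.{w₂, t₂, v₂} E] {P Q : DoubleFunctor D E} (α : DoubleNatTrans P Q)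
  (c : ∀ x : D, Companion (α.app x))

theorem naturality_cell' {x y x' y' : D} {f : x ⟶ x'} {g : y ⟶ y'} {m : Pro x y} {n : Pro x' y'}
    (γ : Cell f g m n) {k : P.obj x ⟶ Q.obj x'} {l : P.obj y ⟶ Q.obj y'}
    (hk : P.map f ≫ α.app x' = k) (hl : P.map g ≫ α.app y' = l) :
    vcomp (P.mapCell γ) (α.appPro n) hk hl = vcomp (α.appPro m) (Q.mapCell γ)
      ((α.naturality f).symm.trans hk) ((α.naturality g).symm.trans hl) := by
  obtain rfl : α.app x ≫ Q.map f = k := (α.naturality f).symm.trans hk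
  obtain rfl : α.app y ≫ Q.map g = l := (α.naturality g).symm.trans hl
  exact α.naturality_cell γ

/-- The component at an arrow of the protransformation given by the companions. -/
def companionArrow {x y : D} (f : x ⟶ y) : Cell (P.map f) (Q.map f) (c x).pro (c y).pro :=
  (c y).liftPid (vcomp (c x).counit (hid (Q.map f)) rfl (Category.id_comp _)) (α.naturality f)

theorem companionArrow_counit {x y : D} (f : x ⟶ y) {k : P.obj x ⟶ Q.obj y} {l : Q.obj x ⟶ Q.obj y}
    (hk : P.map f ≫ α.app y = k) (hl : Q.map f ≫ 𝟙 _ = l) :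
    vcomp (α.companionArrow c f) (c y).counit hk hl =
      vcomp (c x).counit (hid (Q.map f)) ((α.naturality f).symm.trans hk)
        ((Category.id_comp _).trans ((Category.comp_id _).symm.trans hl)) := by
  obtain rfl : Q.map f = l := (Category.comp_id _).symm.trans hl
  obtain rfl : α.app x ≫ Q.map f = k := (α.naturality f).symm.trans hk
  exact (c y).liftPid_counit _ _

/-- After the counit at `y`, both sides become the external identity cell on the naturality square's
diagonal. -/
theorem unit_companionArrow {x y : D} (f : x ⟶ y) {k : P.obj x ⟶ P.obj y} {l : P.obj x ⟶ Q.obj y}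
    (hk : P.map f ≫ 𝟙 _ = k) (hl : P.map f ≫ α.app y = l) (hk' : 𝟙 _ ≫ P.map f = k)
    (hl' : α.app x ≫ Q.map f = l) :
    vcomp (hid (P.map f)) (c y).unit hk hl = vcomp (c x).unit (α.companionArrow c f) hk' hl' := by
  obtain rfl : P.map f = k := (Category.comp_id _).symm.trans hk
  obtain rfl : α.app x ≫ Q.map f = l := hl'
  refine (c y).counit_ext hl (Category.comp_id _) ?_
  rw [vcomp_assoc' _ _ _ _ _ _ _ (Category.id_comp _) (Category.comp_id _) (α.naturality f)
    (α.naturality f), (c y).unit_vcomp_counit, vcomp_assoc' _ _ _ _ _ _ _ (α.naturality f)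
    (Category.comp_id _) (Category.id_comp _) rfl, companionArrow_counit,
    ← vcomp_assoc' _ _ _ (Category.id_comp _) (Category.comp_id _) rfl rfl,
    (c x).unit_vcomp_counit, hid_comp', hid_comp']

theorem slide_appPro_lact {x y : D} (m : Pro x y) :
    vcomp (slide (c x) (c y) (α.appPro m)) (lact (c x).counit (vid (Q.mapPro m)))
      (Category.id_comp _) (Category.id_comp _) = ract (α.appPro m) (c y).counit :=
  slide_lact ..

/-- The oplax protransformation whose components are the companions of those of a natural
transformation. -/
def companionProtrans : OplaxProtrans P Q where
  app x := (c x).pro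
  appArrow := α.companionArrow c
  appPro {x y} m := slide (c x) (c y) (α.appPro m)
  appArrow_id x := by
    -- Functoriality in arrows is uniqueness of factorization: both sides have the same paste with
    -- the counit.
    refine (c x).counit_ext (Category.id_comp _) (Category.comp_id _) ?_
    rw [castCell_vcomp_left, vid_vcomp, companionArrow_counit, vcomp_hid_of_eq _ (Q.map_id x)]
  appArrow_comp {x y z} f g := by
    refine (c z).counit_ext rfl (Category.comp_id _) ?_
    rw [vcomp_assoc' _ _ _ _ _ _ _ rfl (Category.comp_id _) (by simp) (by simp),
      companionArrow_counit, companionArrow_counit, ← vcomp_assoc' (α.companionArrow c f) _ _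
      (α.naturality f) (Category.comp_id _)
      (by rw [Category.assoc, ← Q.map_comp, α.naturality]) (Q.map_comp _ _).symm,
      companionArrow_counit, vcomp_assoc' _ _ _ _ _ _ _ (Q.map_comp _ _).symm (Q.map_comp _ _).symm

      (by rw [α.naturality, Q.map_comp]) (by simp), hid_comp']
  naturality {x y x' y' f g m n} γ := by
    -- Tested against the counit, both sides become right actions by the same cell, and the
    -- remaining equation is naturality of `α` at `γ`.
    refine (c x').lact_ext rfl (Category.comp_id _) ?_
    rw [vcomp_assoc' _ _ _ _ _ _ _ rfl (Category.comp_id _) (Category.id_comp _)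
      (Category.id_comp _), vcomp_lact _ _ _ _ _ (Category.comp_id _), vcomp_vid,
      companionArrow_counit, ← vid_vcomp (Q.mapCell γ), ← lact_vcomp _ _ _ (α.naturality f).symm,
      ← vcomp_assoc' _ _ _ (Category.id_comp _) (Category.id_comp _) (α.naturality f).symm
      (Category.id_comp _), slide_appPro_lact,
      ract_vcomp _ _ _ _ rfl (Category.id_comp _),
      vcomp_assoc' _ _ _ _ _ _ _ (Category.id_comp _) (Category.id_comp _) rfl (Category.comp_id _),
      slide_appPro_lact, vcomp_ract _ _ _ _ _ (α.naturality g), companionArrow_counit,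
      naturality_cell']
  appPro_pcomp {x y z} m n := by
    refine (c x).lact_ext (Category.id_comp _) (Category.comp_id _) ?_
    simp only [gcomp_vcomp]
    -- The counit at `x` is carried leftwards through the composite: the slide at `m` trades it for
    -- the counit at `y`, and the slide at `n` trades that for the counit at `z`. What remains is
    -- `α.app_pcomp`.
    have h₁ := associator_lact (c x).counit (vid (Q.mapPro m)) (vid (Q.mapPro n))
    have h₂ : vcomp (hcomp (slide (c x) (c y) (α.appPro m)) (vid (Q.mapPro n)))
        (hcomp (lact (c x).counit (vid (Q.mapPro m))) (vid (Q.mapPro n))) (Category.id_comp _)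
        (Category.id_comp _) = hcomp (ract (α.appPro m) (c y).counit) (vid (Q.mapPro n)) := by
      rw [← hcomp_vcomp' _ _ _ _ _ (Category.id_comp _), slide_appPro_lact, vid_vcomp]
    have h₃ := associatorInv_vcomp_eq
      (associator_hcomp_lact (α.appPro m) (c y).counit (vid (Q.mapPro n)))
    have h₄ : vcomp (hcomp (vid (P.mapPro m)) (slide (c y) (c z) (α.appPro n)))
        (hcomp (α.appPro m) (lact (c y).counit (vid (Q.mapPro n)))) (Category.id_comp _)
        (Category.id_comp _) = hcomp (α.appPro m) (ract (α.appPro n) (c z).counit) := by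
      rw [← hcomp_vcomp' _ _ _ _ _ (Category.id_comp _), slide_appPro_lact, vid_vcomp]
    have h₅ := associator_ract (α.appPro m) (α.appPro n) (c z).counit
    rw [hcomp_vid] at h₁
    rw [hcomp_vid_lact, vcomp_reassoc h₁, vcomp_reassoc h₂, vcomp_reassoc h₃, vcomp_reassoc h₄,
      vcomp_reassoc h₅, slide_appPro_lact, vcomp_ract _ _ _ _ _ (Category.id_comp _), vid_vcomp,
      ← α.app_pcomp, ract_vcomp _ _ _ _ (Category.comp_id _) (Category.id_comp _), hid_id,
      vcomp_vid]
  appPro_pid x := by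
    refine (c x).lact_ext (Category.id_comp _) (Category.comp_id _) ?_
    simp only [gcomp_vcomp]
    -- The same test at an identity proarrow; here the remaining equation is `α.app_pid`.
    have h₁ : vcomp (runitInv (c x).pro) (lact (c x).counit (vid (pid _))) (Category.id_comp _)
        (Category.id_comp _) = (c x).counit := by
      rw [← hid_id, lact_eq_ract, runitInv_ract_hid]
    rw [hcomp_vid_lact, vcomp_reassoc h₁, slide_appPro_lact,
      vcomp_ract _ _ _ _ _ (Category.id_comp _), vid_vcomp, ← α.app_pid,
      ← vcomp_vid (c x).counit, ← hid_id, ← ract_vcomp _ _ _ (Category.comp_id _), ract_hid_left,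
      hid_id, vcomp_vid]
    apply vcomp_assoc'

/-- The companion of a natural transformation with companions. -/
def protransCompanion : ProtransCompanion α (α.companionProtrans c) where
  unit :=
    { app x := (c x).unit
      app_arrow {x y} f := α.unit_companionArrow c f _ _ _ _
      app_pro {x y} m := by
        -- Each side contains a unit that meets its counit, and both reduce to the right unitor
        -- followed by `α.appPro m`.
        refine (c x).lact_ext (Category.id_comp _) (Category.comp_id _) ?_
        dsimp only [companionProtrans]
        rw [vcomp_assoc' _ _ _ _ _ _ _ (Category.id_comp _) (Category.comp_id _)
          (Category.id_comp _) (Category.id_comp _), vcomp_lact _ _ _ _ _ (Category.comp_id _),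
          (c x).unit_vcomp_counit, vcomp_vid, gcomp_vcomp, lunitInv_lact_hid,
          vcomp_assoc' _ _ _ _ _ _ _ (Category.id_comp _) (Category.id_comp _)
          (Category.id_comp _) (Category.comp_id _), slide_appPro_lact,
          vcomp_ract _ _ _ _ _ (Category.id_comp _), vid_vcomp, (c y).unit_vcomp_counit, ract_hid] }
  counit :=
    { app x := (c x).counit
      app_arrow {x y} f := α.companionArrow_counit c f _ _
      app_pro {x y} m := vcomp_hcomp_counit (α.slide_appPro_lact c m) }
  unit_hcomp_counit x := (c x).unit_hcomp_counit
  unit_vcomp_counit x := (c x).unit_vcomp_counit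

end DoubleNatTrans

/-! ### Pasting of counit equations. -/

namespace DoubleCategory

section Pasting

variable {D : Type u} [DoubleCategory.{w, t, v} D]

/-- The counit equations of two comparison cells paste to that of their external composite. -/
theorem associatorInv_comparison_lact {x x' x'' y y' y'' : D} {f : x ⟶ x'} {f' : x' ⟶ x''}
    {k : x ⟶ x''} {g : y ⟶ y'} {g' : y' ⟶ y''} {l : y ⟶ y''} {m : Pro x y} {n : Pro x' y'}
    {n' : Pro x'' y''} {p : Pro x x'} {p' : Pro x' x''} {q : Pro y y'} {q' : Pro y' y''}
    {σ : GCell (pcomp m q) (pcomp p n)} {τ : GCell (pcomp n q') (pcomp p' n')}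
    {α : Cell f g m n} {β : Cell f' g' n n'} {ε : Cell f (𝟙 x') p (pid x')}
    {κ : Cell g (𝟙 y') q (pid y')} {ε' : Cell f' (𝟙 x'') p' (pid x'')}
    {κ' : Cell g' (𝟙 y'') q' (pid y'')}
    (hσ : vcomp σ (lact ε (vid n)) (Category.id_comp _) (Category.id_comp _) = ract α κ)
    (hτ : vcomp τ (lact ε' (vid n')) (Category.id_comp _) (Category.id_comp _) = ract β κ')
    (hk : f ≫ f' = k) (hl : g ≫ g' = l) :
    vcomp (gcomp (gcomp (gcomp (gcomp (associatorInv m q q') (hcomp σ (vid q')))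
        (associator p n q')) (hcomp (vid p) τ)) (associatorInv p p' n'))
      (lact (vcomp (lact ε (vid p')) ε' hk (Category.id_comp _)) (vid n')) (Category.id_comp _)
      (Category.id_comp _) =
    ract (vcomp α β hk hl) (vcomp (lact κ (vid q')) κ' hl (Category.id_comp _)) := by
  have h₁ : lact (vcomp (lact ε (vid p')) ε' hk (Category.id_comp _)) (vid n') =
      vcomp (hcomp (lact ε (vid p')) (vid n')) (lact ε' (vid n')) hk (Category.id_comp _) := by
    rw [vcomp_lact _ _ _ _ _ (Category.id_comp _), vid_vcomp]
  have h₂ := associatorInv_vcomp_eq (associator_lact ε (vid p') (vid n'))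
  have h₃ := associator_lact ε (vid n) (vid q')
  have h₄ : vcomp (hcomp σ (vid q')) (hcomp (lact ε (vid n)) (vid q')) (Category.id_comp _)
      (Category.id_comp _) = hcomp (ract α κ) (vid q') := by
    rw [← hcomp_vcomp' _ _ _ _ _ (Category.id_comp _), hσ, vid_vcomp]
  have h₅ := associatorInv_vcomp_eq (associator_hcomp_lact α κ (vid q'))
  rw [hcomp_vid] at h₂ h₃
  simp only [gcomp_vcomp]
  rw [h₁, vcomp_reassoc h₂, vcomp_reassoc (hcomp_vid_lact ε τ), vcomp_assoc' _ _ _ _ _ _ _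
    (Category.id_comp _) (Category.id_comp _) hk (Category.comp_id _), hτ, vcomp_reassoc h₃,
    vcomp_reassoc h₄, vcomp_reassoc h₅, vcomp_ract _ _ _ _ _ hl]

/-- The counit equations of the components at an arrow paste under external composition. -/
theorem hcomp_counit {x y z x' y' z' : D} {a : x ⟶ x'} {b : y ⟶ y'} {c : z ⟶ z'}
    {f : x ⟶ y} {f' : y ⟶ z} {g : x' ⟶ y'} {g' : y' ⟶ z'} {k : x ⟶ y'} {i : y ⟶ z'}
    {j : x' ⟶ z'} {j' : x ⟶ z} {l : x ⟶ z'} {r : z ⟶ z'}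
    {p : Pro x y} {p' : Pro y z} {q : Pro x' y'} {q' : Pro y' z'}
    {σ : Cell a b p q} {τ : Cell b c p' q'} {ε : Cell f (𝟙 y) p (pid y)}
    {ε' : Cell f' (𝟙 z) p' (pid z)} {κ : Cell g (𝟙 y') q (pid y')} {κ' : Cell g' (𝟙 z') q' (pid z')}
    {hk : a ≫ g = k} {hk' : f ≫ b = k} {hi : b ≫ g' = i} {hi' : f' ≫ c = i}
    (hσ : vcomp σ κ hk (Category.comp_id _) = vcomp ε (hid b) hk' (Category.id_comp _))
    (hτ : vcomp τ κ' hi (Category.comp_id _) = vcomp ε' (hid c) hi' (Category.id_comp _))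
    (hj : g ≫ g' = j) (hj' : f ≫ f' = j') (hl : a ≫ j = l) (hl' : j' ≫ c = l)
    (hr : c ≫ 𝟙 _ = r) (hr' : 𝟙 _ ≫ c = r) :
    vcomp (hcomp σ τ) (vcomp (lact κ (vid q')) κ' hj (Category.id_comp _)) hl hr =
      vcomp (vcomp (lact ε (vid p')) ε' hj' (Category.id_comp _)) (hid c) hl' hr' := by
  obtain rfl : c = r := (Category.comp_id _).symm.trans hr
  have h₁ : k ≫ g' = l := by rw [← hk, Category.assoc, hj, hl]
  have h₂ : f ≫ i = l := by rw [← hi', ← Category.assoc, hj', hl']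
  have h : vcomp (hcomp σ τ) (lact κ (vid q')) hk (Category.comp_id _) =
      vcomp (lact ε (vid p')) τ hk' (Category.id_comp _) := by
    rw [vcomp_lact _ _ _ _ _ (Category.comp_id _), hσ, vcomp_vid,
      lact_vcomp _ _ _ _ (Category.id_comp _), vid_vcomp]
  rw [vcomp_reassoc h, vcomp_assoc' _ _ _ _ _ _ _ hi (Category.comp_id _) h₂ (Category.id_comp _),
    hτ, vcomp_assoc' _ _ _ _ _ _ _ hi' (Category.id_comp _) h₂ (Category.id_comp _)]

theorem vcomp_inverse {x y x' y' : D} {a : x ⟶ x'} {b : y ⟶ y'} {k l : x ⟶ x'} {k' l' : y ⟶ y'}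
    {p p' : Pro x y} {q q' : Pro x' y'} {σ : Cell a b p q} {τ : Cell a b p' q'} {μ : GCell p p'}
    {μ' : GCell q q'} {ν : GCell p' p} {ν' : GCell q' q} (h₁ : gcomp ν μ = vid p')
    (h₂ : gcomp μ' ν' = vid q) {hk : a ≫ 𝟙 _ = k} {hk' : b ≫ 𝟙 _ = k'} {hl : 𝟙 _ ≫ a = k}
    {hl' : 𝟙 _ ≫ b = k'} (h : vcomp σ μ' hk hk' = vcomp μ τ hl hl')
    (h₃ : a ≫ 𝟙 _ = l) (h₄ : b ≫ 𝟙 _ = l') (h₅ : 𝟙 _ ≫ a = l) (h₆ : 𝟙 _ ≫ b = l') :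
    vcomp τ ν' h₃ h₄ = vcomp ν σ h₅ h₆ := by
  obtain rfl : a = k := (Category.comp_id _).symm.trans hk
  obtain rfl : b = k' := (Category.comp_id _).symm.trans hk'
  obtain rfl : a = l := (Category.comp_id _).symm.trans h₃
  obtain rfl : b = l' := (Category.comp_id _).symm.trans h₄
  have h₇ : vcomp ν (vcomp μ τ hl hl') hl hl' = τ :=
    (gcomp_vcomp ..).symm.trans ((congrArg (vcomp · τ hl hl') h₁).trans (vid_vcomp τ))
  have h₈ : vcomp (vcomp σ μ' hk hk') ν' hk hk' = σ :=
    (vcomp_assoc' ..).trans ((congrArg (vcomp σ · hk hk') h₂).trans (vcomp_vid σ))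
  conv_lhs => rw [← h₇, ← h]
  rw [vcomp_assoc' _ _ _ _ _ _ _ hk hk' (Category.id_comp _) (Category.id_comp _), h₈]

end Pasting

end DoubleCategory

/-! ### Inverse modifications, images of counit equations, and comparison cells at companions. -/

section Modifications

variable {D : Type u₁} [DoubleCategory.{w₁, t₁, v₁} D]
  {E : Type u₂} [DoubleCategory.{w₂, t₂, v₂} E]

/-- A family of componentwise inverses of a globular modification is a modification. -/
def Modification.inverse {P Q : DoubleFunctorBase D E} {σ τ : OplaxProtransData P Q}
    (μ : GModification σ τ) (ν : ∀ x, GCell (τ.app x) (σ.app x))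
    (h₁ : ∀ x, gcomp (μ.app x) (ν x) = vid (σ.app x))
    (h₂ : ∀ x, gcomp (ν x) (μ.app x) = vid (τ.app x)) : GModification τ σ where
  app := ν
  app_arrow {x y} f := vcomp_inverse (h₂ x) (h₁ y) (μ.app_arrow f) _ _ _ _
  app_pro {x y} m := by
    refine vcomp_inverse (μ := hcomp (vid _) (μ.app y)) (μ' := hcomp (μ.app x) (vid _)) ?_ ?_
      (μ.app_pro m) _ _ _ _
    · exact (hcomp_vid_gcomp _ _ _).symm.trans ((congrArg _ (h₂ y)).trans (hcomp_vid _ _))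
    · exact (gcomp_hcomp_vid _ _ _).symm.trans ((congrArg (hcomp · _) (h₁ x)).trans (hcomp_vid _ _))

namespace DoubleFunctor

variable (F : DoubleFunctor D E)

theorem mapCell_mapCounit_of_eq {x y x' y' : D} {a : x ⟶ x'} {b : y ⟶ y'} {f : x ⟶ y}
    {g : x' ⟶ y'} {k : x ⟶ y'} {p : Pro x y} {q : Pro x' y'} {σ : Cell a b p q}
    {ε : Cell f (𝟙 y) p (pid y)} {κ : Cell g (𝟙 y') q (pid y')} {hk : a ≫ g = k} {hk' : f ≫ b = k}
    (h : vcomp σ κ hk (Category.comp_id _) = vcomp ε (hid b) hk' (Category.id_comp _)) :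
    vcomp (F.mapCell σ) (F.mapCounit κ (F.map_id y'))
        ((F.map_comp _ _).symm.trans (congrArg F.map hk)) (Category.comp_id _) =
      vcomp (F.mapCounit ε (F.map_id y)) (hid (F.map b))
        ((F.map_comp _ _).symm.trans (congrArg F.map hk')) (Category.id_comp _) := by
  rw [← F.vcomp_mapCounit σ κ hk (Category.comp_id _) (F.map_id y') rfl, h,
    F.vcomp_mapCounit ε (hid b) hk' (Category.id_comp _) rfl rfl, F.mapCounit_hid, mapCounit,
    vcomp_assoc']

/-- The counit equation of the image of a comparison cell. -/
theorem mapGlob_lact {x x' y y' : D} {f : x ⟶ x'} {g : y ⟶ y'} {m : Pro x y} {n : Pro x' y'}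
    {p : Pro x x'} {q : Pro y y'} {τ : GCell (pcomp m q) (pcomp p n)} {α : Cell f g m n}
    {ε : Cell f (𝟙 x') p (pid x')} {κ : Cell g (𝟙 y') q (pid y')}
    (h : vcomp τ (lact ε (vid n)) (Category.id_comp _) (Category.id_comp _) = ract α κ) :
    vcomp (gcomp (gcomp (F.mapComp m q) (F.mapGlob τ)) (F.mapCompInv p n))
      (lact (F.mapCounit ε (F.map_id x')) (vid (F.mapPro n))) (Category.id_comp _)
      (Category.id_comp _) = ract (F.mapCell α) (F.mapCounit κ (F.map_id y')) := by
  rw [lact_mapCounit_vid, ract_mapCounit, ← h, F.mapCell_vcomp', gcomp_vcomp, gcomp_vcomp,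
    vcomp_reassoc (F.mapCompInv_mapComp p n), DoubleFunctorBase.mapGlob, castCell_vcomp_left, vid_vcomp', vcomp_castCell]
  apply vcomp_congr_boundary

end DoubleFunctor

namespace DoubleNatTrans

variable {P Q : DoubleFunctor D E} (α : DoubleNatTrans P Q) (c : ∀ x : D, Companion (α.app x))

theorem appPro_pid_mapIdInv (x : D) {k : P.obj x ⟶ Q.obj x} (hk : α.app x ≫ 𝟙 _ = k)
    (hk' : 𝟙 _ ≫ α.app x = k) :
    vcomp (α.appPro (pid x)) (Q.mapIdInv x) hk hk =
      vcomp (P.mapIdInv x) (hid (α.app x)) hk' hk' := by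
  obtain rfl : α.app x = k := (Category.comp_id _).symm.trans hk
  have h : vcomp (P.mapIdInv x) (vcomp (P.mapId x) (α.appPro (pid x)) hk' hk') hk' hk' =
      α.appPro (pid x) :=
    (gcomp_vcomp ..).symm.trans
      ((congrArg (vcomp · _ hk' hk') (P.mapIdInv_mapId x)).trans (vid_vcomp _))
  have h' : vcomp (vcomp (hid (α.app x)) (Q.mapId x) hk hk) (Q.mapIdInv x) hk hk =
      hid (α.app x) :=
    (vcomp_assoc' ..).trans
      ((congrArg (vcomp _ · hk hk) (Q.mapId_mapIdInv x)).trans (vcomp_vid _))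
  rw [← h, ← α.app_pid, vcomp_assoc' _ _ _ _ _ _ _ hk hk hk' hk', h']

/-- Naturality of `α` at the cell `ε`, with the unit coherence of `α` removing the component at `pid
y'`. -/
theorem appPro_mapCounit {x y y' : D} {f : x ⟶ y'} {g : y ⟶ y'} {p : Pro x y}
    (ε : Cell f g p (pid y')) {a : Q.obj y ⟶ Q.obj y'} {b : P.obj y ⟶ P.obj y'}
    {k : P.obj x ⟶ Q.obj y'} {l : P.obj y ⟶ Q.obj y'} (ha : Q.map g = a) (hb : P.map g = b)
    (hk : α.app x ≫ Q.map f = k) (hl : α.app y ≫ a = l) :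
    vcomp (α.appPro p) (Q.mapCounit ε ha) hk hl =
      vcomp (P.mapCounit ε hb) (hid (α.app y')) ((α.naturality f).trans hk)
        (by rw [← hl, ← ha, ← hb, α.naturality]) := by
  subst ha hb hk hl
  rw [DoubleFunctor.mapCounit, DoubleFunctor.mapCounit, ← vcomp_assoc' _ _ _ rfl rfl (Category.comp_id _) (Category.comp_id _),
    ← α.naturality_cell, vcomp_assoc' _ _ _ _ _ _ _ (Category.comp_id _) (Category.comp_id _)
    (α.naturality f) (α.naturality g), α.appPro_pid_mapIdInv y' _ (Category.id_comp _)]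
  apply (vcomp_assoc' ..).symm

/-- Naturality of `α` gives `P f ; α_y = α_x ; Q f`, so the source and target of the slide are
companions of one arrow. By `appPro_mapCounit` the slide respects their counits, and such a cell is
invertible. -/
theorem isInvertible_slide_companion {x y : D} {f : x ⟶ y} (d : Companion f) :
    IsInvertible (slide (c x) (c y) (α.appPro d.pro)) := by
  refine ((P.mapCompanion d).comp (c y) (α.naturality f)).isInvertible_of_counit
    ((c x).comp (Q.mapCompanion d) rfl) _ ?_
  change vcomp (slide _ _ _) (vcomp (lact (c x).counit (vid (Q.mapPro d.pro)))
    (Q.mapCounit d.counit (Q.map_id y)) rfl (Category.id_comp _)) _ _ =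
    vcomp (lact (P.mapCounit d.counit (P.map_id y)) (vid (c y).pro)) (c y).counit _ _
  rw [vcomp_reassoc (α.slide_appPro_lact c d.pro), ract_vcomp _ _ _ _ (Category.comp_id _)
    (Category.id_comp _), hid_id, vcomp_vid, α.appPro_mapCounit d.counit (Q.map_id y) (P.map_id y),
    ← lact_eq_ract, lact_vcomp _ _ _ _ (Category.id_comp _), vid_vcomp]

end DoubleNatTrans

end Modifications

/-! ### The invertible modifications from the triangle identities. -/

namespace DoubleAdjunction

variable {D : Type u₁} [DoubleCategory.{w₁, t₁, v₁} D]
  {E : Type u₂} [DoubleCategory.{w₂, t₂, v₂} E] {F : DoubleFunctor D E} {G : DoubleFunctor E D}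
  (adj : DoubleAdjunction F G) (cη : ∀ x : D, Companion (adj.unit.app x))
  (cε : ∀ y : E, Companion (adj.counit.app y))

/-- The composite of the companions of `F η_x` and `ε_{Fx}`. -/
def leftCompanion (x : D) : Companion (𝟙 (F.obj x)) :=
  (F.mapCompanion (cη x)).comp (cε (F.obj x)) (adj.left_triangle x)

/-- The composite of the companions of `η_{Gy}` and `G ε_y`. -/
def rightCompanion (y : E) : Companion (𝟙 (G.obj y)) :=
  (cη (G.obj y)).comp (G.mapCompanion (cε y)) (adj.right_triangle y)

theorem leftCompanion_counit (x : D) : (adj.leftCompanion cη cε x).counit =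
    vcomp (lact (F.mapCounit (cη x).counit (F.map_id _)) (vid (cε (F.obj x)).pro))
      (cε (F.obj x)).counit (adj.left_triangle x) (Category.id_comp _) :=
  rfl

/-- The counits of the companions of `F η_x ; ε_{Fx}` form a modification. -/
def leftModification : GModification
    (OplaxProtransData.comp
      ((adj.unit.companionProtrans cη).toOplaxProtransData.postWhisker F)
      ((adj.counit.companionProtrans cε).toOplaxProtransData.preWhisker F.toDoubleFunctorBase))
    (OplaxProtransData.id F.toDoubleFunctorBase) where
  app x := (adj.leftCompanion cη cε x).counit
  app_arrow {x y} f := hcomp_counit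
    (F.mapCell_mapCounit_of_eq (adj.unit.companionArrow_counit cη f rfl (Category.comp_id _)))
    (adj.counit.companionArrow_counit cε (F.map f) rfl (Category.comp_id _)) _ _ _ _ _ _
  app_pro {x y} m := by
    -- The counit equations of `F * η_!` and `ε_! * F` at `m` paste to one for the cell `F η_m ;
    -- ε_{Fm}`, which the triangle identity at proarrows makes the identity.
    refine vcomp_hcomp_counit ((associatorInv_comparison_lact
      (F.mapGlob_lact (adj.unit.slide_appPro_lact cη m))
      (adj.counit.slide_appPro_lact cε (F.mapPro m)) (adj.left_triangle x)
      (adj.left_triangle y)).trans ?_)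
    rw [adj.left_triangle_pro m]
    rfl

/-- The counits of the companions of `η_{Gy} ; G ε_y` form a modification. -/
def rightModification : GModification
    (OplaxProtransData.comp
      ((adj.unit.companionProtrans cη).toOplaxProtransData.preWhisker G.toDoubleFunctorBase)
      ((adj.counit.companionProtrans cε).toOplaxProtransData.postWhisker G))
    (OplaxProtransData.id G.toDoubleFunctorBase) where
  app y := (adj.rightCompanion cη cε y).counit
  app_arrow {x y} f := hcomp_counit
    (adj.unit.companionArrow_counit cη (G.map f) rfl (Category.comp_id _))
    (G.mapCell_mapCounit_of_eq (adj.counit.companionArrow_counit cε f rfl (Category.comp_id _)))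
    _ _ _ _ _ _
  app_pro {x y} m := by
    refine vcomp_hcomp_counit ((associatorInv_comparison_lact
      (adj.unit.slide_appPro_lact cη (G.mapPro m))
      (G.mapGlob_lact (adj.counit.slide_appPro_lact cε m)) (adj.right_triangle x)
      (adj.right_triangle y)).trans ?_)
    rw [adj.right_triangle_pro m]
    rfl

/-- The invertible modification `1_F ⟶ (F * η_!) ⊙ (ε_! * F)`. -/
def leftInvertibleModification : InvertibleModification
    (P := F.toDoubleFunctorBase) (Q := F.toDoubleFunctorBase)
    (OplaxProtransData.id F.toDoubleFunctorBase)
    (OplaxProtransData.comp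
      ((adj.unit.companionProtrans cη).toOplaxProtransData.postWhisker F)
      ((adj.counit.companionProtrans cε).toOplaxProtransData.preWhisker F.toDoubleFunctorBase))
    where
  -- Equivariance is checked for the counits alone; the units inherit it as their componentwise
  -- inverses.
  hom := (adj.leftModification cη cε).inverse (fun x => (adj.leftCompanion cη cε x).unit)
    (fun x => (adj.leftCompanion cη cε x).counit_gcomp_unit)
    (fun x => (adj.leftCompanion cη cε x).unit_gcomp_counit)
  inv := adj.leftModification cη cε
  hom_inv x := (adj.leftCompanion cη cε x).unit_gcomp_counit
  inv_hom x := (adj.leftCompanion cη cε x).counit_gcomp_unit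

/-- The invertible modification `(η_! * G) ⊙ (G * ε_!) ⟶ 1_G`. -/
def rightInvertibleModification : InvertibleModification
    (P := G.toDoubleFunctorBase) (Q := G.toDoubleFunctorBase)
    (OplaxProtransData.comp
      ((adj.unit.companionProtrans cη).toOplaxProtransData.preWhisker G.toDoubleFunctorBase)
      ((adj.counit.companionProtrans cε).toOplaxProtransData.postWhisker G))
    (OplaxProtransData.id G.toDoubleFunctorBase) where
  hom := adj.rightModification cη cε
  inv := (adj.rightModification cη cε).inverse (fun y => (adj.rightCompanion cη cε y).unit)
    (fun y => (adj.rightCompanion cη cε y).counit_gcomp_unit)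
    (fun y => (adj.rightCompanion cη cε y).unit_gcomp_counit)
  hom_inv y := (adj.rightCompanion cη cε y).counit_gcomp_unit
  inv_hom y := (adj.rightCompanion cη cε y).unit_gcomp_counit

end DoubleAdjunction

/-! ### The swallowtail identities, reduced to counit equations. -/

namespace DoubleCategory

section Swallowtails

variable {D : Type u} [DoubleCategory.{w, t, v} D]

/-- For the unit, `c.pro`, `q`, `n`, `r` stand for `(η_!)_x`, `(η_!)_{GFx}`, `GF(η_!)_x`,
`G(ε_!)_{Fx}`, with `φ` for `t⁻¹` and `ψ` for `G s⁻¹`. The composite is tested against `c.counit`: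
`hσ` replaces the comparison cell by `α`, and `hα` then exchanges the counit `κ` of `n` for the
counit `ε` of `q`. This turns `ψ` into the composite counit that `φ` cancels by `hφ`, leaving
`c.counit`. -/
theorem swallowtail_of_counit {x y z : D} {f : x ⟶ y} {g f' : y ⟶ z} {h : z ⟶ y} {k : x ⟶ z}
    (c : Companion f) {q n : Pro y z} {r : Pro z y} {σ : GCell (pcomp c.pro q) (pcomp c.pro n)}
    {α : Cell f g c.pro n} {ε : Cell g (𝟙 z) q (pid z)} {κ : Cell f' (𝟙 z) n (pid z)}
    {ν : Cell h (𝟙 y) r (pid y)} {hk : f ≫ f' = k} {hk' : f ≫ g = k} {hg : g ≫ h = 𝟙 y}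
    {hf : f' ≫ h = 𝟙 y} {φ : GCell (pid y) (pcomp q r)} {ψ : GCell (pcomp n r) (pid y)}
    (hσ : vcomp σ (lact c.counit (vid n)) (Category.id_comp _) (Category.id_comp _) = ract α ε)
    (hα : vcomp α κ hk (Category.comp_id _) = vcomp c.counit (hid g) hk' (Category.id_comp _))
    (hφ : vcomp φ (vcomp (lact ε (vid r)) ν hg (Category.id_comp _)) (Category.id_comp _)
      (Category.id_comp _) = vid _)
    (hψ : ψ = vcomp (lact κ (vid r)) ν hf (Category.id_comp _)) :
    gcomp (gcomp (gcomp (gcomp (gcomp (gcomp (runitInv c.pro) (hcomp (vid c.pro) φ))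
      (associatorInv c.pro q r)) (hcomp σ (vid r))) (associator c.pro n r))
      (hcomp (vid c.pro) ψ)) (runit c.pro) = vid c.pro := by
  refine c.counit_ext (Category.id_comp _) (Category.comp_id _) ?_
  have h₁ := associator_lact c.counit (vid n) (vid r)
  have h₂ : vcomp (hcomp σ (vid r)) (hcomp (lact c.counit (vid n)) (vid r))
      (Category.id_comp _) (Category.id_comp _) = hcomp (ract α ε) (vid r) := by
    rw [← hcomp_vcomp' _ _ _ _ _ (Category.id_comp _), hσ, vid_vcomp]
  have h₃ := associatorInv_vcomp_eq (associator_hcomp_lact α ε (vid r))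
  have h₄ : vcomp (hcomp α (lact ε (vid r))) (lact κ (vid r)) hk (Category.comp_id _) =
      vcomp (lact c.counit (vid (pcomp q r))) (lact ε (vid r)) hk' (Category.comp_id _) := by
    rw [vcomp_lact _ _ _ _ _ (Category.comp_id _), vcomp_vid, hα,
      lact_vcomp _ _ _ _ (Category.id_comp _), vid_vcomp]
  have h₅ : vcomp (runitInv c.pro) (lact c.counit (vid (pid y))) (Category.id_comp _)
      (Category.id_comp _) = c.counit := by
    rw [← hid_id, lact_eq_ract, runitInv_ract_hid]
  rw [hcomp_vid] at h₁
  simp only [gcomp_vcomp]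
  rw [← lact_counit_pid, hcomp_vid_lact, hψ, vcomp_reassoc h₁, vcomp_reassoc h₂, vcomp_reassoc h₃,
    vcomp_reassoc h₄, vcomp_assoc' _ _ _ _ _ _ _ hg (Category.id_comp _) (Category.comp_id _)
    (Category.comp_id _), vcomp_reassoc (hcomp_vid_lact c.counit φ),
    vcomp_assoc' _ φ _ _ _ _ _ (Category.id_comp _) (Category.id_comp _) (Category.comp_id _)
    (Category.comp_id _), hφ, vcomp_vid, h₅, vid_vcomp]

/-- The counterpart for the counit: `c.pro`, `q`, `n`, `r` stand for `(ε_!)_y`, `(ε_!)_{FGy}`,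
`FG(ε_!)_y`, `F(η_!)_{Gy}`, with `φ` for `F t⁻¹` and `ψ` for `s⁻¹`. It is not a formal mirror image,
since companions are tested by their counits on one side only; `h₄` is where `ε` is exchanged for
`κ`. -/
theorem swallowtail_of_counit' {x y z : D} {f : x ⟶ y} {g f' : z ⟶ x} {h : x ⟶ z} {k : z ⟶ y}
    (c : Companion f) {q n : Pro z x} {r : Pro x z} {σ : GCell (pcomp n c.pro) (pcomp q c.pro)}
    {α : Cell g f n c.pro} {ε : Cell g (𝟙 x) q (pid x)} {κ : Cell f' (𝟙 x) n (pid x)}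
    {ν : Cell h (𝟙 z) r (pid z)} {hk : g ≫ f = k} {hk' : f' ≫ f = k} {hg : h ≫ g = 𝟙 x}
    {hf : h ≫ f' = 𝟙 x} {φ : GCell (pid x) (pcomp r n)} {ψ : GCell (pcomp r q) (pid x)}
    (hσ : vcomp σ (lact ε (vid c.pro)) (Category.id_comp _) (Category.id_comp _) =
      ract α c.counit)
    (hα : vcomp α c.counit hk (Category.comp_id _) = vcomp κ (hid f) hk' (Category.id_comp _))
    (hφ : vcomp φ (vcomp (lact ν (vid n)) κ hf (Category.id_comp _)) (Category.id_comp _)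
      (Category.id_comp _) = vid _)
    (hψ : ψ = vcomp (lact ν (vid q)) ε hg (Category.id_comp _)) :
    gcomp (gcomp (gcomp (gcomp (gcomp (gcomp (lunitInv c.pro) (hcomp φ (vid c.pro)))
      (associator r n c.pro)) (hcomp (vid r) σ)) (associatorInv r q c.pro))
      (hcomp ψ (vid c.pro))) (lunit c.pro) = vid c.pro := by
  refine c.counit_ext (Category.id_comp _) (Category.comp_id _) ?_
  have h₁ : vcomp (hcomp ψ (vid c.pro)) (lunit c.pro) (Category.id_comp _) (Category.id_comp _) =
      vcomp (hcomp (lact ν (vid q)) (vid c.pro)) (lact ε (vid c.pro)) hg (Category.id_comp _) := by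
    rw [vcomp_lact _ _ _ _ _ (Category.id_comp _), vid_vcomp, ← hψ, lact]
  have h₂ := associatorInv_vcomp_eq (associator_lact ν (vid q) (vid c.pro))
  have h₃ := associator_lact ν (vid n) (vid c.pro)
  have h₄ : vcomp (ract α c.counit) c.counit hk (Category.comp_id _) =
      vcomp (lact κ (vid c.pro)) c.counit hk' (Category.id_comp _) := by
    rw [ract_vcomp _ _ _ _ (Category.comp_id _) (Category.comp_id _), hα, ← lact_eq_ract, hid_id,
      vcomp_vid, lact_vcomp _ _ _ _ (Category.id_comp _), vid_vcomp]
  have h₅ : vcomp (hcomp (lact ν (vid n)) (vid c.pro)) (lact κ (vid c.pro)) hf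
      (Category.id_comp _) =
      lact (vcomp (lact ν (vid n)) κ hf (Category.id_comp _)) (vid c.pro) := by
    rw [vcomp_lact _ _ _ _ _ (Category.id_comp _), vid_vcomp]
  have h₆ : vcomp (hcomp φ (vid c.pro))
      (lact (vcomp (lact ν (vid n)) κ hf (Category.id_comp _)) (vid c.pro)) (Category.id_comp _)
      (Category.id_comp _) = lunit c.pro := by
    rw [vcomp_lact _ _ _ _ _ (Category.id_comp _), hφ, vid_vcomp, ← hid_id, lact_hid, vcomp_vid]
  have h₇ : h ≫ k = f := by rw [← hk', ← Category.assoc, hf, Category.id_comp]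
  rw [hcomp_vid] at h₂ h₃
  simp only [gcomp_vcomp]
  rw [vcomp_reassoc h₁, vcomp_assoc' (hcomp _ _) _ c.counit _ _ _ _ hk (Category.comp_id _) h₇
    (Category.id_comp _), vcomp_reassoc h₂, vcomp_reassoc (hcomp_vid_lact ν σ),
    vcomp_assoc' _ σ _ _ _ _ _ (Category.id_comp _) (Category.id_comp _) h₇ (Category.id_comp _),
    vcomp_reassoc hσ, h₄, vcomp_reassoc h₃, vcomp_reassoc h₅, vcomp_reassoc h₆,
    vcomp_reassoc (lunitInv_lunit _)]

end Swallowtails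

end DoubleCategory

/-! ### Images of composite counits under double functors. -/

namespace DoubleFunctor

variable {C : Type u} [DoubleCategory.{w, t, v} C] {D : Type u₁} [DoubleCategory.{w₁, t₁, v₁} D]
  {E : Type u₂} [DoubleCategory.{w₂, t₂, v₂} E]

theorem comp_mapCounit (F : DoubleFunctor C D) (G : DoubleFunctor D E) {x y y' : C} {f : x ⟶ y'}
    {g : y ⟶ y'} {p : Pro x y} (ε : Cell f g p (pid y')) {a : F.obj y ⟶ F.obj y'}
    {b : G.obj (F.obj y) ⟶ G.obj (F.obj y')} (ha : F.map g = a) (hb : G.map a = b)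
    (hb' : (F.comp G).map g = b) :
    (F.comp G).mapCounit ε hb' = G.mapCounit (F.mapCounit ε ha) hb := by
  subst ha hb
  rw [mapCounit, mapCounit, mapCounit, G.mapCell_vcomp']
  change vcomp _ (gcomp (G.mapGlob (F.mapIdInv y')) (G.mapIdInv (F.obj y'))) _ _ = _
  rw [DoubleFunctorBase.mapGlob, gcomp, castCell_vcomp_left]
  exact (vcomp_assoc' ..).symm

theorem id_mapCounit {x y y' : C} {f : x ⟶ y'} {g : y ⟶ y'} {p : Pro x y}
    (ε : Cell f g p (pid y')) : (DoubleFunctor.id C).mapCounit ε rfl = ε :=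
  vcomp_vid ε

theorem mapGlob_mapIdInv (H : DoubleFunctor D E) {x y z : D} {f : x ⟶ y} {g : y ⟶ z} {k : x ⟶ z}
    {p : Pro x y} {q : Pro y z} (ε : Cell f (𝟙 y) p (pid y)) (κ : Cell g (𝟙 z) q (pid z))
    (h : f ≫ g = k) {l : H.obj x ⟶ H.obj z} (hl : H.map k = l) (hl' : H.map f ≫ H.map g = l) :
    vcomp (vcomp (H.mapComp p q) (H.mapCell (vcomp (lact ε (vid q)) κ h (Category.id_comp _)))
        ((Category.id_comp _).trans hl) ((Category.id_comp _).trans (H.map_id z)))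
      (H.mapIdInv z) (Category.comp_id _) (Category.id_comp _) =
    vcomp (lact (H.mapCounit ε (H.map_id y)) (vid (H.mapPro q))) (H.mapCounit κ (H.map_id z))
      hl' (Category.id_comp _) := by
  subst hl h
  rw [lact_mapCounit_vid, vcomp_assoc' _ _ _ _ _ _ _ (Category.comp_id _)
    ((Category.comp_id _).trans (H.map_id z)) (Category.id_comp _) (Category.id_comp _),
    vcomp_assoc' (H.mapComp p q) _ _ _ _ _ _ (H.map_comp f g).symm
    ((Category.comp_id _).trans (H.map_id z)) (Category.id_comp _) (Category.id_comp _),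
    ← H.vcomp_mapCounit (lact ε (vid q)) κ rfl (Category.id_comp _) (H.map_id z) (H.map_id z),
    mapCounit]

/-- Identifies the image of `s⁻¹`, with the comparison cells inserted, as a composite of image
counits; this is the form of `ψ` that `swallowtail_of_counit` takes. -/
theorem mapGlob_counit (H : DoubleFunctor D E) {x y : D} {f : x ⟶ y} {g : y ⟶ x}
    {p : Pro x y} {q : Pro y x} (ε : Cell f (𝟙 y) p (pid y)) (κ : Cell g (𝟙 x) q (pid x))
    (h : f ≫ g = 𝟙 x) (h' : H.map f ≫ H.map g = 𝟙 _) :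
    gcomp (gcomp (H.mapComp p q) (H.mapGlob (vcomp (lact ε (vid q)) κ h (Category.id_comp _))))
        (H.mapIdInv x) =
      vcomp (lact (H.mapCounit ε (H.map_id y)) (vid (H.mapPro q))) (H.mapCounit κ (H.map_id x)) h'
        (Category.id_comp _) := by
  rw [← H.mapGlob_mapIdInv ε κ h (H.map_id _), DoubleFunctorBase.mapGlob, gcomp, gcomp,
    vcomp_castCell]

/-- The counit equation of the image of a section of the counit of a composite. -/
theorem mapId_mapGlob_counit (H : DoubleFunctor D E) {x y : D} {f : x ⟶ y} {g : y ⟶ x}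
    {p : Pro x y} {q : Pro y x} {ε : Cell f (𝟙 y) p (pid y)} {κ : Cell g (𝟙 x) q (pid x)}
    {h : f ≫ g = 𝟙 x} {φ : GCell (pid x) (pcomp p q)}
    (hφ : vcomp φ (vcomp (lact ε (vid q)) κ h (Category.id_comp _)) (Category.id_comp _)
      (Category.id_comp _) = vid _) (h' : H.map f ≫ H.map g = 𝟙 _) :
    vcomp (gcomp (gcomp (H.mapId x) (H.mapGlob φ)) (H.mapCompInv p q))
      (vcomp (lact (H.mapCounit ε (H.map_id y)) (vid (H.mapPro q))) (H.mapCounit κ (H.map_id x))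
        h' (Category.id_comp _)) (Category.id_comp _) (Category.id_comp _) = vid _ := by
  rw [← H.mapGlob_counit ε κ h]
  change gcomp (gcomp (gcomp _ _) _) (gcomp (gcomp _ _) _) = _
  have e' := (H.mapGlob_gcomp φ (vcomp (lact ε (vid q)) κ h (Category.id_comp _))).symm.trans
    ((congrArg H.mapGlob hφ).trans (H.mapGlob_vid _))
  rw [gcomp_assoc, ← gcomp_assoc (H.mapCompInv p q), ← gcomp_assoc (H.mapCompInv p q),
    H.mapCompInv_mapComp, vid_gcomp, gcomp_assoc, ← gcomp_assoc (H.mapGlob φ), e', vid_gcomp,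
    H.mapId_mapIdInv]

end DoubleFunctor

/-! ### Assembly of the lax adjunction. -/

namespace DoubleAdjunction

variable {D : Type u₁} [DoubleCategory.{w₁, t₁, v₁} D]
  {E : Type u₂} [DoubleCategory.{w₂, t₂, v₂} E] {F : DoubleFunctor D E} {G : DoubleFunctor E D}
  (adj : DoubleAdjunction F G) (cη : ∀ x : D, Companion (adj.unit.app x))
  (cε : ∀ y : E, Companion (adj.counit.app y))

/-- Naturality of `η` at a counit, with the counit of the composite `GF` written as an iterated
image. At the companion of `η_x` it is the exchange hypothesis `hα` of `swallowtail_of_counit`. -/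
theorem unit_appPro_mapCounit {x y : D} {f : x ⟶ y} {p : Pro x y} (ε : Cell f (𝟙 y) p (pid y)) :
    vcomp (adj.unit.appPro p) (G.mapCounit (F.mapCounit ε (F.map_id _)) (G.map_id _)) rfl
        (Category.comp_id _) =
      vcomp ε (hid (adj.unit.app y)) (adj.unit.naturality f) (Category.id_comp _) := by
  rw [← DoubleFunctor.comp_mapCounit F G ε (F.map_id _) (G.map_id _) ((F.comp G).map_id _)]
  refine (adj.unit.appPro_mapCounit ε ((F.comp G).map_id _) rfl rfl (Category.comp_id _)).trans ?_
  rw [DoubleFunctor.id_mapCounit]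

theorem counit_appPro_vcomp {x y : E} {f : x ⟶ y} {p : Pro x y} (ε : Cell f (𝟙 y) p (pid y)) :
    vcomp (adj.counit.appPro p) ε rfl (Category.comp_id _) =
      vcomp (F.mapCounit (G.mapCounit ε (G.map_id _)) (F.map_id _)) (hid (adj.counit.app y))
        (adj.counit.naturality f) (Category.id_comp _) := by
  rw [← DoubleFunctor.comp_mapCounit G F ε (G.map_id _) (F.map_id _) ((G.comp F).map_id _)]
  refine Eq.trans ?_ (adj.counit.appPro_mapCounit ε rfl ((G.comp F).map_id _) rfl
    (Category.comp_id _))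
  rw [DoubleFunctor.id_mapCounit]

/-- The lax adjunction of companions. -/
def laxAdjunction : LaxAdjunction F G where
  unit := adj.unit.companionProtrans cη
  counit := adj.counit.companionProtrans cε
  s := adj.leftInvertibleModification cη cε
  t := adj.rightInvertibleModification cη cε
  swallowtail_unit x := swallowtail_of_counit (cη x) (adj.unit.slide_appPro_lact cη (cη x).pro)
    (adj.unit_appPro_mapCounit (cη x).counit)
    (adj.rightCompanion cη cε (F.obj x)).unit_gcomp_counit
    (G.mapGlob_counit _ _ (adj.left_triangle x)
      (by rw [← G.map_comp, adj.left_triangle, G.map_id]))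
  swallowtail_counit y := swallowtail_of_counit' (cε y)
    (adj.counit.slide_appPro_lact cε (cε y).pro) (adj.counit_appPro_vcomp (cε y).counit)
    -- Here `F` is applied to the section `t⁻¹`, the unit of `rightCompanion`, whereas `s⁻¹` enters
    -- directly as the counit of `leftCompanion`.
    (F.mapId_mapGlob_counit (adj.rightCompanion cη cε y).unit_gcomp_counit
      (by rw [← F.map_comp, adj.right_triangle, F.map_id]))
    (adj.leftCompanion_counit cη cε (G.obj y))

end DoubleAdjunction

theorem mainTheorem3 {D : Type u₁} [DoubleCategory.{w₁, t₁, v₁} D]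
    {E : Type u₂} [DoubleCategory.{w₂, t₂, v₂} E]
    (F : DoubleFunctor D E) (G : DoubleFunctor E D) (adj : DoubleAdjunction F G)
    (cη : ∀ x : D, Companion (adj.unit.app x)) (cε : ∀ y : E, Companion (adj.counit.app y)) :
    ∃ (A : LaxAdjunction F G)
      (K : ProtransCompanion adj.unit A.unit) (L : ProtransCompanion adj.counit A.counit),
      (∀ x : D, K.companion x = cη x) ∧ (∀ y : E, L.companion y = cε y) ∧
      (∀ x : D, IsInvertible (A.unit.appPro (A.unit.app x))) ∧
      (∀ y : E, IsInvertible (A.counit.appPro (A.counit.app y))) ∧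
      ((∀ {x y : D} (m : Pro x y), IsCommuter (cη x) (cη y) (adj.unit.appPro m)) →
        (∀ {x y : E} (m : Pro x y), IsCommuter (cε x) (cε y) (adj.counit.appPro m)) →
        A.IsBiadjunction) :=
  ⟨adj.laxAdjunction cη cε, adj.unit.protransCompanion cη, adj.counit.protransCompanion cε,
    -- The invertible comparison cells are obtained by taking the companion of `η_x` itself as the
    -- proarrow at which `η_!` is evaluated, and likewise for `ε_!`.
    fun _ => rfl, fun _ => rfl, fun x => adj.unit.isInvertible_slide_companion cη (cη x),
    fun y => adj.counit.isInvertible_slide_companion cε (cε y),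
    -- The comparison cells are by construction the slides of `η_m` and `ε_m`, so the commuter
    -- hypotheses are literally the pseudo conditions.
    fun h h' => ⟨h, h'⟩⟩
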